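/- Let $\mathfrak M=(M,\mathbf g,\nabla,\tau_{\mathbf g},\uparrow)$ be a Lorentzian spacetime: $M$ is a smooth, connected, paracompact (Hausdorff), noncompact 4-manifold, $\mathbf g$ is a smooth Lorentzian metric of signature $(1,3)$, $\nabla$ is its Levi-Civita connection, $\tau_{\mathbf g}$ is a metric volume element fixing an orientation, and $\uparrow$ is a time orientation. Assume that $\mathfrak M$ is a spin manifold, in the (by Geroch's theorem equivalent) sense that it carries a global tetrad, and let $\{\mathbf e_{\mathbf a}\}$ be any global tetrad, that is, a smooth oriented and time-oriented frame with $\mathbf g(\mathbf e_{\mathbf a},\mathbf e_{\mathbf b})=\eta_{\mathbf{ab}}$, $\eta=\mathrm{diag}(1,-1,-1,-1)$; let $\{\theta^{\mathbf a}\}$ be the dual cotetrad, $\theta^{\mathbf a}(\mathbf e_{\mathbf b})=\delta^{\mathbf a}_{\mathbf b}$. Let $\mathcal T$ be a covariant 2-tensor field on $M$, put $T^{\mathbf a}_{\mathbf b}=\eta^{\mathbf{ac}}\mathcal T(\mathbf e_{\mathbf c},\mathbf e_{\mathbf b})$, $\mathcal T^{\mathbf a}=T^{\mathbf a}_{\mathbf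 b}\theta^{\mathbf b}$, and let $T=T^{\mathbf a}_{\mathbf a}$ be its metric trace. Conventions. The curvature is $\mathbf R(u,v)w=\nabla_u\nabla_vw-\nabla_v\nabla_uw-\nabla_{[u,v]}w$; the Ricci tensor is taken with the sign $\mathrm{Ricci}(u,v)=\mathrm{tr}\big(w\mapsto\mathbf R(v,w)u\big)$, i.e. $R^{\mu}_{\beta}=g^{\rho\alpha}R_{\rho}{}^{\mu}{}_{\alpha\beta}$ with $\mathbf R(e_\alpha,e_\beta)e_\rho=R_\rho{}^\mu{}_{\alpha\beta}e_\mu$; and $R$ is the metric trace of $\mathrm{Ricci}$. In the Clifford bundle $\mathcal{C}\ell(T^*M)$ of differential forms, generated by $\theta^{\mathbf a}\theta^{\mathbf b}+\theta^{\mathbf b}\theta^{\mathbf a}=2\eta^{\mathbf{ab}}$, the connection acts by $\nabla_vA=v(A)+\tfrac12[\omega_v,A]$, where $v(A)$ differentiates the components of $A$ in the basis of exterior products of the $\theta^{\mathbf a}$, and $\omega_v=\tfrac12\omega_v^{\mathbf{bc}}\theta_{\mathbf b}\theta_{\mathbf c}$ with $\omega_v^{\mathbf{bc}}=\theta^{\mathbf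 b}(\nabla_v\mathbf e_{\mathbf d})\eta^{\mathbf{dc}}$, $\theta_{\mathbf b}=\eta_{\mathbf{bd}}\theta^{\mathbf d}$. The Dirac operator is $\boldsymbol\partial=\theta^{\mathbf a}\nabla_{\mathbf e_{\mathbf a}}=\boldsymbol\partial\wedge+\boldsymbol\partial\lrcorner$, with $\boldsymbol\partial\wedge A=\theta^{\mathbf a}\wedge\nabla_{\mathbf e_{\mathbf a}}A$ and $\boldsymbol\partial\lrcorner A=\theta^{\mathbf a}\lrcorner\nabla_{\mathbf e_{\mathbf a}}A$ (left contraction); $\boldsymbol\partial\cdot A=\boldsymbol\partial\lrcorner A$ when $A$ is a 1-form field. The covariant D'Alembertian is $\boldsymbol\partial\cdot\boldsymbol\partial=\eta^{\mathbf{ab}}\big(\nabla_{\mathbf e_{\mathbf a}}\nabla_{\mathbf e_{\mathbf b}}-\omega^{\mathbf c}_{\mathbf{ab}}\nabla_{\mathbf e_{\mathbf c}}\big)$, where $\nabla_{\mathbf e_{\mathbf a}}\mathbf e_{\mathbf b}=\omega^{\mathbf c}_{\mathbf{ab}}\mathbf e_{\mathbf c}$. Then Einstein's equation (in natural units) $$\mathrm{Ricci}-\tfrac12R\,\mathbf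 g=\mathcal T$$ holds on $M$ if and only if the cotetrad fields satisfy on $M$ $$-(\boldsymbol\partial\cdot\boldsymbol\partial)\theta^{\mathbf a}+\boldsymbol\partial\wedge(\boldsymbol\partial\cdot\theta^{\mathbf a})+\boldsymbol\partial\lrcorner(\boldsymbol\partial\wedge\theta^{\mathbf a})=\mathcal T^{\mathbf a}-\tfrac12T\,\theta^{\mathbf a},\qquad \mathbf a=0,1,2,3 .$$ In that case $T=-R$. -/

import Mathlib

open Bundle Module
open scoped Manifold ContDiff

/-- The diagonal entries of `η = diag(1, -1, -1, -1)`. -/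
def minkowski : Fin 4 → ℝ := ![1, -1, -1, -1]

/-- The entries `η_{ab} = η^{ab}` of the Minkowski matrix. -/
def eta (a b : Fin 4) : ℝ := if a = b then minkowski a else 0

section Spacetime

variable (M : Type*) [TopologicalSpace M] [ChartedSpace (EuclideanSpace ℝ (Fin 4)) M]
  [IsManifold (𝓡 4) ∞ M]

/-- A Lorentzian spacetime `(M, g, ∇, τ, ↑)`: a smooth Lorentzian metric of signature `(1, 3)`,
its (smooth, metric, torsion-free) Levi-Civita connection, a metric volume element and a time
orientation. As in Mathlib, `conn Y x v` is the covariant derivative `(∇_v Y)(x)`. -/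
structure LorentzianSpacetime where
  /-- The metric `g`. -/
  metric (x : M) : TangentSpace (𝓡 4) x →L[ℝ] TangentSpace (𝓡 4) x →L[ℝ] ℝ
  metric_symm (x : M) (u v : TangentSpace (𝓡 4) x) : metric x u v = metric x v u
  metric_signature (x : M) : ∃ b : Basis (Fin 4) ℝ (TangentSpace (𝓡 4) x),
    ∀ i j, metric x (b i) (b j) = eta i j
  metric_smooth : ContMDiff (𝓡 4)
    ((𝓡 4).prod 𝓘(ℝ, EuclideanSpace ℝ (Fin 4) →L[ℝ] EuclideanSpace ℝ (Fin 4) →L[ℝ] ℝ)) ∞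
    (fun x ↦ TotalSpace.mk'
      (EuclideanSpace ℝ (Fin 4) →L[ℝ] EuclideanSpace ℝ (Fin 4) →L[ℝ] ℝ) x (metric x))
  /-- The connection `∇`. -/
  conn : CovariantDerivative (𝓡 4) (EuclideanSpace ℝ (Fin 4)) (TangentSpace (𝓡 4) : M → Type _)
  conn_smooth : ContMDiffCovariantDerivativeOn (EuclideanSpace ℝ (Fin 4)) ∞ conn.toFun Set.univ
  conn_metric : ∀ (x : M) (X Y : Π y : M, TangentSpace (𝓡 4) y),
    MDifferentiableAt (𝓡 4) (𝓡 4).tangent (T% X) x →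
    MDifferentiableAt (𝓡 4) (𝓡 4).tangent (T% Y) x → ∀ v : TangentSpace (𝓡 4) x,
      mvfderiv (𝓡 4) (fun y ↦ metric y (X y) (Y y)) x v
        = metric x (conn X x v) (Y x) + metric x (X x) (conn Y x v)
  conn_torsion : conn.torsion = 0
  /-- The metric volume element `τ`, which fixes the orientation. -/
  vol (x : M) : TangentSpace (𝓡 4) x [⋀^Fin 4]→ₗ[ℝ] ℝ
  vol_unit (x : M) (b : Basis (Fin 4) ℝ (TangentSpace (𝓡 4) x)) :
    (∀ i j, metric x (b i) (b j) = eta i j) → |vol x b| = 1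
  vol_smooth (X : Fin 4 → Π x : M, TangentSpace (𝓡 4) x) :
    (∀ i, ContMDiff (𝓡 4) (𝓡 4).tangent ∞ (T% (X i))) →
      ContMDiff (𝓡 4) 𝓘(ℝ, ℝ) ∞ (fun x ↦ vol x (fun i ↦ X i x))
  /-- The time orientation `↑`: the future-pointing timelike vectors at each event. -/
  future (x : M) : Set (TangentSpace (𝓡 4) x)
  future_spec : ∃ Z : Π x : M, TangentSpace (𝓡 4) x,
    ContMDiff (𝓡 4) (𝓡 4).tangent ∞ (T% Z) ∧ (∀ x, 0 < metric x (Z x) (Z x)) ∧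
    ∀ x v, v ∈ future x ↔ 0 < metric x v v ∧ 0 < metric x v (Z x)

end Spacetime

noncomputable section

namespace LorentzianSpacetime

variable {M : Type*} [TopologicalSpace M] [ChartedSpace (EuclideanSpace ℝ (Fin 4)) M]
  [IsManifold (𝓡 4) ∞ M] (S : LorentzianSpacetime M)

/-! ### Metric, cometric, curvature and Einstein's equation -/

/-- An orthonormal basis of `T_x M` (used only to write traces, which do not depend on it). -/
def stdBasis (x : M) : Basis (Fin 4) ℝ (TangentSpace (𝓡 4) x) := (S.metric_signature x).choose

theorem metric_stdBasis (x : M) (i j : Fin 4) :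
    S.metric x (S.stdBasis x i) (S.stdBasis x j) = eta i j :=
  (S.metric_signature x).choose_spec i j

/-- The metric at `x` as a bilinear form. -/
def bilin (x : M) : LinearMap.BilinForm ℝ (TangentSpace (𝓡 4) x) :=
  LinearMap.mk₂ ℝ (fun u v ↦ S.metric x u v) (by simp) (by simp) (by simp) (by simp)

/-- A family that is orthonormal for the metric is linearly independent. -/
theorem linearIndependent_of_orthonormal {x : M} {b : Fin 4 → TangentSpace (𝓡 4) x}
    (hb : ∀ i j, S.metric x (b i) (b j) = eta i j) : LinearIndependent ℝ b := by
  rw [Fintype.linearIndependent_iff]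
  intro c hc i
  have h : S.metric x (∑ j, c j • b j) (b i) = 0 := by rw [hc]; simp
  have h' : c i * minkowski i = 0 := by
    simpa [hb, eta] using h
  have hm : minkowski i ≠ 0 := by fin_cases i <;> simp [minkowski]
  exact (mul_eq_zero.mp h').resolve_right hm

theorem bilin_nondegenerate (x : M) : (S.bilin x).Nondegenerate := by
  have key : ∀ u : TangentSpace (𝓡 4) x, (∀ v, S.metric x u v = 0) → u = 0 := by
    intro u hu
    have hrepr : ∀ i, (S.stdBasis x).repr u i = 0 := by
      intro i
      have h := hu (S.stdBasis x i)
      rw [← (S.stdBasis x).sum_repr u] at h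
      have h' : (S.stdBasis x).repr u i * minkowski i = 0 := by
        simpa [-Basis.sum_repr, S.metric_stdBasis, eta] using h
      have hm : minkowski i ≠ 0 := by fin_cases i <;> simp [minkowski]
      exact (mul_eq_zero.mp h').resolve_right hm
    rw [← (S.stdBasis x).sum_repr u]
    simp [-Basis.sum_repr, hrepr]
  refine ⟨fun u hu ↦ key u (fun v ↦ hu v), fun u hu ↦ key u (fun v ↦ ?_)⟩
  rw [S.metric_symm]
  exact hu v

instance finiteDimensional_tangentSpace (x : M) : FiniteDimensional ℝ (TangentSpace (𝓡 4) x) :=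
  inferInstanceAs (FiniteDimensional ℝ (EuclideanSpace ℝ (Fin 4)))

/-- The musical isomorphism `T_x^* M → T_x M`. -/
def sharp (x : M) : Dual ℝ (TangentSpace (𝓡 4) x) ≃ₗ[ℝ] TangentSpace (𝓡 4) x :=
  ((S.bilin x).toDual (S.bilin_nondegenerate x)).symm

/-- The metric of the cotangent space at `x`. -/
def cometric (x : M) : LinearMap.BilinForm ℝ (Dual ℝ (TangentSpace (𝓡 4) x)) :=
  (S.bilin x).compl₁₂ (S.sharp x).toLinearMap (S.sharp x).toLinearMap

/-- The Riemann curvature `R(u, v) w = ∇_u ∇_v w - ∇_v ∇_u w - ∇_{[u, v]} w` at `x`, computed on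
the smooth local extensions of `u`, `v`, `w` provided by `FiberBundle.extend`. -/
def riemann (x : M) (u v w : TangentSpace (𝓡 4) x) : TangentSpace (𝓡 4) x :=
  let U : Π y : M, TangentSpace (𝓡 4) y := FiberBundle.extend (EuclideanSpace ℝ (Fin 4)) u
  let V : Π y : M, TangentSpace (𝓡 4) y := FiberBundle.extend (EuclideanSpace ℝ (Fin 4)) v
  let W : Π y : M, TangentSpace (𝓡 4) y := FiberBundle.extend (EuclideanSpace ℝ (Fin 4)) w
  S.conn (fun y ↦ S.conn W y (V y)) x u - S.conn (fun y ↦ S.conn W y (U y)) x v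
    - S.conn W x (VectorField.mlieBracket (𝓡 4) U V x)

/-- The Ricci tensor, with the sign convention
`Ricci(u, v) = trace (w ↦ R(v, w) u) = g^{ρα} g(R(e_α, v) e_ρ, u)`. -/
def ricci (x : M) (u v : TangentSpace (𝓡 4) x) : ℝ :=
  ∑ i, (S.stdBasis x).repr (S.riemann x v (S.stdBasis x i) u) i

/-- The metric trace `g^{ij} B_{ij}` of a covariant `2`-tensor at `x`. -/
def metricTrace (x : M) (B : TangentSpace (𝓡 4) x → TangentSpace (𝓡 4) x → ℝ) : ℝ :=
  ∑ i, minkowski i * B (S.stdBasis x i) (S.stdBasis x i)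

/-- The curvature scalar. -/
def scalarCurvature (x : M) : ℝ := S.metricTrace x (S.ricci x)

/-- Einstein's equation `Ricci - ½ R g = 𝒯`. -/
def EinsteinEquation (T : Π x : M, LinearMap.BilinForm ℝ (TangentSpace (𝓡 4) x)) : Prop :=
  ∀ (x : M) (u v : TangentSpace (𝓡 4) x),
    S.ricci x u v - 1 / 2 * S.scalarCurvature x * S.metric x u v = T x u v

/-! ### The Clifford bundle of differential forms -/

/-- The quadratic form of the cotangent space at `x`. -/
def coform (x : M) : QuadraticForm ℝ (Dual ℝ (TangentSpace (𝓡 4) x)) :=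
  (S.cometric x).toQuadraticMap

/-- The fibre at `x` of the Clifford bundle of differential forms, so that
`α β + β α = 2 g(α, β)` for covectors. -/
abbrev Cliff (x : M) : Type _ := CliffordAlgebra (S.coform x)

/-- Sections of the Clifford bundle. -/
abbrev CliffField : Type _ := Π x : M, S.Cliff x

/-- The embedding of covectors in the Clifford bundle. -/
def ofCovector {x : M} (α : Dual ℝ (TangentSpace (𝓡 4) x)) : S.Cliff x :=
  CliffordAlgebra.ι (S.coform x) α

/-- The exterior product `α ∧ A` of a covector and a multiform, through the identification of the
exterior algebra with the Clifford algebra. -/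
def wedge {x : M} (α : Dual ℝ (TangentSpace (𝓡 4) x)) (A : S.Cliff x) : S.Cliff x :=
  (CliffordAlgebra.equivExterior (S.coform x)).symm
    (ExteriorAlgebra.ι ℝ α * CliffordAlgebra.equivExterior (S.coform x) A)

/-- The left contraction `α ⌟ A` of a multiform by a covector. For a covector `A` it is the scalar
product `α · A`. -/
def contract {x : M} (α : Dual ℝ (TangentSpace (𝓡 4) x)) (A : S.Cliff x) : S.Cliff x :=
  CliffordAlgebra.contractLeft (S.cometric x α) A

/-- The Clifford product by a covector: `α A = α ∧ A + α ⌟ A`. -/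
theorem ofCovector_mul {x : M} (α : Dual ℝ (TangentSpace (𝓡 4) x)) (A : S.Cliff x) :
    S.ofCovector α * A = S.wedge α A + S.contract α A := by
  have hsymm : ∀ β, (QuadraticMap.associated (R := ℝ) (-S.coform x)) α β = -S.cometric x α β := by
    intro β
    have h : S.cometric x β α = S.cometric x α β := by
      simp [cometric, bilin, S.metric_symm x (S.sharp x β)]
    simp [QuadraticMap.associated_apply, coform, h]
    ring
  have hB : (QuadraticMap.associated (R := ℝ) (-S.coform x)) α = -S.cometric x α := by
    ext β; exact hsymm β
  apply (CliffordAlgebra.equivExterior (S.coform x)).injective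
  rw [map_add, wedge, contract, LinearEquiv.apply_symm_apply]
  simp only [CliffordAlgebra.equivExterior, CliffordAlgebra.changeFormEquiv_apply, ofCovector,
    CliffordAlgebra.changeForm_ι_mul, CliffordAlgebra.changeForm_contractLeft, hB]
  simp [ExteriorAlgebra.ι]

/-- A global tetrad: a smooth section of the bundle of oriented, time-oriented orthonormal frames. -/
structure Tetrad where
  /-- The frame fields `e_a`. -/
  e : Fin 4 → Π x : M, TangentSpace (𝓡 4) x
  smooth (a : Fin 4) : ContMDiff (𝓡 4) (𝓡 4).tangent ∞ (T% (e a))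
  orthonormal (x : M) (a b : Fin 4) : S.metric x (e a x) (e b x) = eta a b
  oriented (x : M) : 0 < S.vol x (fun a ↦ e a x)
  time_oriented (x : M) : e 0 x ∈ S.future x

namespace Tetrad

variable {S} (F : S.Tetrad)

/-- The tetrad at `x`, as a basis of the tangent space. -/
def basis (x : M) : Basis (Fin 4) ℝ (TangentSpace (𝓡 4) x) :=
  basisOfLinearIndependentOfCardEqFinrank (b := fun a ↦ F.e a x)
    (S.linearIndependent_of_orthonormal (F.orthonormal x))
    (by
      have h : finrank ℝ (TangentSpace (𝓡 4) x) = finrank ℝ (EuclideanSpace ℝ (Fin 4)) := rfl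
      rw [h]; simp)

/-- The cotetrad at `x`, as a basis of the cotangent space. -/
def cobasis (x : M) : Basis (Fin 4) ℝ (Dual ℝ (TangentSpace (𝓡 4) x)) := (F.basis x).dualBasis

/-- The cotetrad fields `θ^a`, with `θ^a(e_b) = δ^a_b`. -/
def coframe (a : Fin 4) (x : M) : Dual ℝ (TangentSpace (𝓡 4) x) := F.cobasis x a

/-- The cotetrad fields `θ^a` as sections of the Clifford bundle. -/
def theta (a : Fin 4) : S.CliffField := fun x ↦ S.ofCovector (F.coframe a x)

/-- The connection coefficients `ω^b_c(v) = θ^b(∇_v e_c)`. -/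
def omega (b c : Fin 4) (x : M) (v : TangentSpace (𝓡 4) x) : ℝ :=
  F.coframe b x (S.conn (F.e c) x v)

/-- The Clifford connection `2`-form `ω_v = ½ ω_v^{bc} θ_b θ_c`, where `ω_v^{bc} = ω^b_d(v) η^{dc}`
and `θ_b = η_{bd} θ^d`. -/
def connForm (x : M) (v : TangentSpace (𝓡 4) x) : S.Cliff x :=
  (1 / 2 : ℝ) • ∑ b, ∑ c, (F.omega b c x v * minkowski c) •
    ((minkowski b • F.theta b x) * (minkowski c • F.theta c x))

/-- The basis `θ^{a₁} ∧ ⋯ ∧ θ^{a_k}`, `a₁ < ⋯ < a_k`, of the Clifford algebra at `x`. -/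
def cliffBasis (x : M) : Basis (Finset (Fin 4)) ℝ (S.Cliff x) :=
  (F.cobasis x).ExteriorAlgebra.map (CliffordAlgebra.equivExterior (S.coform x)).symm

/-- The derivative `v(A)` of the components of `A` in the basis generated by the cotetrad. -/
def frameDeriv (A : S.CliffField) (x : M) (v : TangentSpace (𝓡 4) x) : S.Cliff x :=
  ∑ s, (mvfderiv (𝓡 4) (fun y ↦ (F.cliffBasis y).repr (A y) s) x v) • F.cliffBasis x s

/-- The covariant derivative `∇_v A = v(A) + ½ [ω_v, A]` of a section of the Clifford bundle. -/
def covDeriv (A : S.CliffField) (x : M) (v : TangentSpace (𝓡 4) x) : S.Cliff x :=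
  F.frameDeriv A x v + (1 / 2 : ℝ) • (F.connForm x v * A x - A x * F.connForm x v)

/-- The field `∇_{e_a} A`. -/
def nabla (a : Fin 4) (A : S.CliffField) : S.CliffField := fun x ↦ F.covDeriv A x (F.e a x)

/-- The Dirac operator `∂ A = θ^a ∇_{e_a} A`. -/
def dirac (A : S.CliffField) : S.CliffField := fun x ↦ ∑ a, F.theta a x * F.nabla a A x

/-- The operator `∂∧ A = θ^a ∧ ∇_{e_a} A`. -/
def diracWedge (A : S.CliffField) : S.CliffField :=
  fun x ↦ ∑ a, S.wedge (F.coframe a x) (F.nabla a A x)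

/-- The operator `∂⌟ A = θ^a ⌟ ∇_{e_a} A`; on a `1`-form field `A` it is `∂ · A`. -/
def diracContract (A : S.CliffField) : S.CliffField :=
  fun x ↦ ∑ a, S.contract (F.coframe a x) (F.nabla a A x)

/-- The Dirac operator is the sum `∂ = ∂∧ + ∂⌟` of its exterior part and its contraction part. -/
theorem dirac_eq (A : S.CliffField) (x : M) :
    F.dirac A x = F.diracWedge A x + F.diracContract A x := by
  simp only [dirac, diracWedge, diracContract, theta, S.ofCovector_mul, Finset.sum_add_distrib]

/-- The covariant D'Alembertian
`(∂ · ∂) A = η^{ab} (∇_{e_a} ∇_{e_b} A - ω^c_{ab} ∇_{e_c} A)`, `ω^c_{ab} = θ^c(∇_{e_a} e_b)`. -/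
def dAlembertian (A : S.CliffField) : S.CliffField :=
  fun x ↦ ∑ a, ∑ b, eta a b • (F.nabla a (F.nabla b A) x
    - ∑ c, F.omega c b x (F.e a x) • F.nabla c A x)

/-- The energy-momentum `1`-form fields `𝒯^a = T^a_b θ^b`, with `T^a_b = η^{ac} 𝒯(e_c, e_b)`. -/
def energyForm (T : Π x : M, LinearMap.BilinForm ℝ (TangentSpace (𝓡 4) x)) (a : Fin 4) :
    S.CliffField :=
  fun x ↦ ∑ b, (∑ c, eta a c * T x (F.e c x) (F.e b x)) • F.theta b x

/-- The system
`-(∂ · ∂) θ^a + ∂ ∧ (∂ · θ^a) + ∂ ⌟ (∂ ∧ θ^a) = 𝒯^a - ½ T θ^a`, `a = 0, 1, 2, 3`. -/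
def CotetradEquation (T : Π x : M, LinearMap.BilinForm ℝ (TangentSpace (𝓡 4) x)) : Prop :=
  ∀ (a : Fin 4) (x : M),
    -F.dAlembertian (F.theta a) x + F.diracWedge (F.diracContract (F.theta a)) x
        + F.diracContract (F.diracWedge (F.theta a)) x
      = F.energyForm T a x - (1 / 2 * S.metricTrace x (fun u v ↦ T x u v)) • F.theta a x

end Tetrad

end LorentzianSpacetime

end

/-!
Write `G^a_{db} = θ^a(∇_{e_b} e_d)` for the connection coefficients of the tetrad, so that
`∇_{e_b} θ^a = -G^a_{db} θ^d` (`connBracket_theta`: the commutator with the connection form acts on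
covectors as the Levi-Civita connection, because `G` is antisymmetric in its first two indices).

With `D²_{cb} = ∇_{e_c} ∇_{e_b} - ω^k_{cb} ∇_{e_k}` the three terms of the operator are
`∂·∂ = η^{cb} D²_{cb}`, `∂∧(∂·θ^a) = θ^c (θ^b ⌟ D²_{cb} θ^a)` and
`∂⌟(∂∧θ^a) = η^{cb} D²_{cb} θ^a - θ^b (θ^c ⌟ D²_{cb} θ^a)`. Hence
`-(∂·∂) θ^a + ∂∧(∂·θ^a) + ∂⌟(∂∧θ^a) = θ^c (θ^b ⌟ (D²_{cb} - D²_{bc}) θ^a)`, and since the torsion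
vanishes the bracket is the curvature acting on `θ^a`. This is `ricciOperator_theta`; the
antisymmetry of the curvature in its first two indices turns the contraction into the Ricci
`1`-form `Ricci^a_m θ^m` (`ricci_e`). The equation of the cotetrad fields is therefore
`Ricci = 𝒯 - ½ T g` in tetrad components (`cotetradEquation_iff`), the trace-reversed form of
Einstein's equation in dimension four.

Since `riemann` and `ricci` are defined through extensions of tangent vectors and an unrelated
orthonormal basis, two facts connect them with the tetrad. The curvature is a tensor, with
`R(u, v) w = w^k R(u, v) e_k` (`riemann_eq`). Here the second derivatives of the components `w^k`
cancel by `U(V f) - V(U f) = [U, V] f`, which follows from the Jacobi identity for `U`, `V` and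
`f e` with a nonvanishing field `e` (`mvfderiv_mlieBracket_apply`). Moreover both traces are traces
of endomorphisms, so they do not depend on the basis (`metricTrace_eq`, `ricci_eq`).
-/

open Filter Topology VectorField

/-! ### Derivations along vector fields -/

section Derivation

variable {E : Type*} [NormedAddCommGroup E] [NormedSpace ℝ E]
  {H : Type*} [TopologicalSpace H] {I : ModelWithCorners ℝ E H}
  {M : Type*} [TopologicalSpace M] [ChartedSpace H M]

theorem ContMDiffAt.eventually_mdifferentiableAt [IsManifold I ∞ M] {H' E' M' : Type*}
    [NormedAddCommGroup E'] [NormedSpace ℝ E'] [TopologicalSpace H'] {I' : ModelWithCorners ℝ E' H'}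
    [TopologicalSpace M'] [ChartedSpace H' M'] [IsManifold I' ∞ M'] {f : M → M'} {x : M}
    (hf : ContMDiffAt I I' 1 f x) : ∀ᶠ y in 𝓝 x, MDifferentiableAt I I' f y :=
  ((contMDiffAt_iff_contMDiffAt_nhds (by simp)).1 hf).mono
    fun _ hy ↦ hy.mdifferentiableAt one_ne_zero

theorem MDifferentiableAt.fun_finsetSum {ι : Type*} (s : Finset ι) {f : ι → M → ℝ} {x : M}
    (hf : ∀ i ∈ s, MDifferentiableAt I 𝓘(ℝ, ℝ) (f i) x) :
    MDifferentiableAt I 𝓘(ℝ, ℝ) (fun y ↦ ∑ i ∈ s, f i y) x := by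
  classical
  induction s using Finset.induction_on with
  | empty => simpa using mdifferentiableAt_const
  | insert a s ha ih =>
    rw [Finset.forall_mem_insert] at hf
    simp only [Finset.sum_insert ha]
    exact hf.1.add (ih hf.2)

theorem mvfderiv_finsetSum {ι : Type*} (s : Finset ι) {f : ι → M → ℝ} {x : M}
    (hf : ∀ i ∈ s, MDifferentiableAt I 𝓘(ℝ, ℝ) (f i) x) :
    mvfderiv I (fun y ↦ ∑ i ∈ s, f i y) x = ∑ i ∈ s, mvfderiv I (f i) x := by
  classical
  induction s using Finset.induction_on with
  | empty => simpa using mvfderiv_const (I := I) (0 : ℝ) (x := x)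
  | insert a s ha ih =>
    rw [Finset.forall_mem_insert] at hf
    simp only [Finset.sum_insert ha, ← ih hf.2]
    exact mvfderiv_add hf.1 (MDifferentiableAt.fun_finsetSum s hf.2)

theorem mvfderiv_const_mul {f : M → ℝ} {x : M} (c : ℝ) (hf : MDifferentiableAt I 𝓘(ℝ, ℝ) f x)
    (v : TangentSpace I x) :
    mvfderiv I (fun y ↦ c * f y) x v = c * mvfderiv I f x v := by
  have h := mvfderiv_mul (I := I) (f := fun _ : M ↦ c) mdifferentiableAt_const hf
  rw [mvfderiv_const, smul_zero, add_zero] at h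
  exact congrArg (fun L ↦ L v) h

/-- `U(V f) - V(U f) = [U, V] f`. The Jacobi identity for `U`, `V` and `f e` gives this identity
multiplied by the vector `e`, whence the auxiliary field `e`. -/
theorem mvfderiv_mlieBracket_apply [CompleteSpace E] [IsManifold I ∞ M] {f : M → ℝ}
    {U V e : Π y : M, TangentSpace I y} {x : M}
    (hf : ContMDiffAt I 𝓘(ℝ, ℝ) 2 f x) (hU : ContMDiffAt I I.tangent 2 (T% U) x)
    (hV : ContMDiffAt I I.tangent 2 (T% V) x) (he : ContMDiffAt I I.tangent 2 (T% e) x)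
    (hex : e x ≠ 0)
    (hfU : MDifferentiableAt I 𝓘(ℝ, ℝ) (fun y ↦ mvfderiv I f y (U y)) x)
    (hfV : MDifferentiableAt I 𝓘(ℝ, ℝ) (fun y ↦ mvfderiv I f y (V y)) x) :
    mvfderiv I (fun y ↦ mvfderiv I f y (V y)) x (U x)
        - mvfderiv I (fun y ↦ mvfderiv I f y (U y)) x (V x)
      = mvfderiv I f x (mlieBracket I U V x) := by
  have : IsManifold I (minSmoothness ℝ 3) M := by
    rw [minSmoothness_of_isRCLikeNormedField]; infer_instance
  have : IsManifold I (minSmoothness ℝ 2) M := by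
    rw [minSmoothness_of_isRCLikeNormedField]; infer_instance
  have hf1 : MDifferentiableAt I 𝓘(ℝ, ℝ) f x := hf.mdifferentiableAt two_ne_zero
  have he1 : MDifferentiableAt I I.tangent (T% e) x := he.mdifferentiableAt two_ne_zero
  have hbr : ∀ {X Y : Π y : M, TangentSpace I y}, ContMDiffAt I I.tangent 2 (T% X) x →
      ContMDiffAt I I.tangent 2 (T% Y) x →
      MDifferentiableAt I I.tangent (T% (mlieBracket I X Y)) x := by
    intro X Y hX hY
    have : IsManifold I ((2 : ℕ∞) + 1) M := inferInstanceAs (IsManifold I 3 M)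
    have h := ContMDiffAt.mlieBracket_vectorField (m := 1) (n := 2) hX hY (by
      rw [minSmoothness_of_isRCLikeNormedField]; norm_num)
    exact h.mdifferentiableAt one_ne_zero
  have hev : ∀ X : Π y : M, TangentSpace I y, mlieBracket I X (f • e) =ᶠ[𝓝 x]
      (fun y ↦ mvfderiv I f y (X y)) • e + f • mlieBracket I X e := by
    intro X
    filter_upwards [(hf.of_le one_le_two).eventually_mdifferentiableAt,
      (he.of_le one_le_two).eventually_mdifferentiableAt] with y hfy hey
    exact mlieBracket_smul_right hfy hey
  have key : ∀ {X Y : Π y : M, TangentSpace I y}, ContMDiffAt I I.tangent 2 (T% X) x →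
      ContMDiffAt I I.tangent 2 (T% Y) x →
      MDifferentiableAt I 𝓘(ℝ, ℝ) (fun y ↦ mvfderiv I f y (Y y)) x →
      mlieBracket I X (mlieBracket I Y (f • e)) x
        = (mvfderiv I (fun y ↦ mvfderiv I f y (Y y)) x (X x) • e x
            + mvfderiv I f x (Y x) • mlieBracket I X e x)
          + (mvfderiv I f x (X x) • mlieBracket I Y e x
            + f x • mlieBracket I X (mlieBracket I Y e) x) := by
    intro X Y hX hY hfY
    rw [EventuallyEq.mlieBracket_vectorField_eq (EventuallyEq.refl _ X) (hev Y),
      mlieBracket_add_right (hfY.smul_section he1) (hf1.smul_section (hbr hY he)),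
      mlieBracket_smul_right hfY he1, mlieBracket_smul_right hf1 (hbr hY he)]
  have h2 : minSmoothness ℝ 2 ≤ 2 := minSmoothness_of_isRCLikeNormedField.le
  have hJ := leibniz_identity_mlieBracket_apply (W := f • e) (hU.of_le h2) (hV.of_le h2)
    ((hf.smul_section he).of_le h2)
  have hJe := leibniz_identity_mlieBracket_apply (W := e) (hU.of_le h2) (hV.of_le h2)
    (he.of_le h2)
  rw [key hU hV hfV, key hV hU hfU, (hev (mlieBracket I U V)).eq_of_nhds] at hJ
  simp only [Pi.add_apply, Pi.smul_apply', hJe] at hJ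
  rw [← sub_eq_zero]
  refine (smul_eq_zero.1 ?_).resolve_right hex
  rw [sub_smul, sub_smul]
  linear_combination (norm := module) hJ

end Derivation

/-! ### Connection coefficients of a tetrad -/

theorem minkowski_mul_self (a : Fin 4) : minkowski a * minkowski a = 1 := by
  fin_cases a <;> simp [minkowski]

theorem minkowski_ne_zero (a : Fin 4) : minkowski a ≠ 0 := by
  fin_cases a <;> simp [minkowski]

namespace LorentzianSpacetime

variable {M : Type*} [TopologicalSpace M] [ChartedSpace (EuclideanSpace ℝ (Fin 4)) M]
  [IsManifold (𝓡 4) ∞ M] {S : LorentzianSpacetime M}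

theorem contMDiffAt_metric {n : ℕ∞} {X Y : Π y : M, TangentSpace (𝓡 4) y} {x : M}
    (hX : ContMDiffAt (𝓡 4) (𝓡 4).tangent n (T% X) x)
    (hY : ContMDiffAt (𝓡 4) (𝓡 4).tangent n (T% Y) x) :
    ContMDiffAt (𝓡 4) 𝓘(ℝ, ℝ) n (fun y ↦ S.metric y (X y) (Y y)) x := by
  have hg : ContMDiffAt (𝓡 4)
      ((𝓡 4).prod 𝓘(ℝ, EuclideanSpace ℝ (Fin 4) →L[ℝ] EuclideanSpace ℝ (Fin 4) →L[ℝ] ℝ)) n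
      (fun y ↦ TotalSpace.mk'
        (EuclideanSpace ℝ (Fin 4) →L[ℝ] EuclideanSpace ℝ (Fin 4) →L[ℝ] ℝ)
        (E := fun y : M ↦ TangentSpace (𝓡 4) y →L[ℝ] TangentSpace (𝓡 4) y →L[ℝ] ℝ)
        y (S.metric y)) x :=
    (S.metric_smooth x).of_le (by exact_mod_cast le_top)
  have h : ContMDiffAt (𝓡 4) ((𝓡 4).prod 𝓘(ℝ, ℝ)) n
      (fun y ↦ TotalSpace.mk' ℝ (E := Bundle.Trivial M ℝ) y (S.metric y (X y) (Y y))) x := by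
    apply ContMDiffAt.clm_bundle_apply₂ (F₁ := EuclideanSpace ℝ (Fin 4))
      (F₂ := EuclideanSpace ℝ (Fin 4))
    · exact hg
    · exact hX
    · exact hY
  simp only [contMDiffAt_totalSpace] at h
  exact h.2

/-- The components of a vector in an orthonormal basis. -/
theorem repr_eq_metric {x : M} (b : Basis (Fin 4) ℝ (TangentSpace (𝓡 4) x))
    (hb : ∀ i j, S.metric x (b i) (b j) = eta i j) (v : TangentSpace (𝓡 4) x) (i : Fin 4) :
    b.repr v i = minkowski i * S.metric x v (b i) := by
  have h : S.metric x v (b i) = minkowski i * b.repr v i := by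
    conv_lhs => rw [← b.sum_repr v]
    simp [-Basis.sum_repr, hb, eta, mul_comm]
  rw [h, ← mul_assoc, minkowski_mul_self, one_mul]

namespace Tetrad

variable (F : S.Tetrad)

@[simp]
theorem basis_apply (x : M) (a : Fin 4) : F.basis x a = F.e a x := by
  simp [basis]

@[simp]
theorem coframe_e (a b : Fin 4) (x : M) : F.coframe a x (F.e b x) = if a = b then 1 else 0 := by
  rw [← F.basis_apply, coframe, cobasis, Basis.coe_dualBasis, Basis.coord_apply,
    Basis.repr_self, Finsupp.single_apply]
  simp only [eq_comm]

theorem coframe_eq_repr (a : Fin 4) (x : M) (v : TangentSpace (𝓡 4) x) :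
    F.coframe a x v = (F.basis x).repr v a := by
  simp [coframe, cobasis]

theorem sum_coframe_smul (x : M) (v : TangentSpace (𝓡 4) x) :
    ∑ a, F.coframe a x v • F.e a x = v := by
  simpa [coframe_eq_repr] using (F.basis x).sum_repr v

theorem coframe_eq_metric (a : Fin 4) (x : M) (v : TangentSpace (𝓡 4) x) :
    F.coframe a x v = minkowski a * S.metric x v (F.e a x) := by
  rw [coframe_eq_repr, repr_eq_metric (S := S) (F.basis x) (by simpa using F.orthonormal x),
    basis_apply]

theorem metric_e_right (a : Fin 4) (x : M) (v : TangentSpace (𝓡 4) x) :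
    S.metric x v (F.e a x) = minkowski a * F.coframe a x v := by
  rw [coframe_eq_metric, ← mul_assoc, minkowski_mul_self, one_mul]

theorem covector_ext {x : M} {α β : Dual ℝ (TangentSpace (𝓡 4) x)}
    (h : ∀ a, α (F.e a x) = β (F.e a x)) : α = β :=
  (F.basis x).ext fun a ↦ by simpa using h a

theorem contMDiffAt_e (n : ℕ∞) (a : Fin 4) (x : M) :
    ContMDiffAt (𝓡 4) (𝓡 4).tangent n (T% (F.e a)) x :=
  (F.smooth a x).of_le (by exact_mod_cast le_top)

theorem contMDiffAt_coframe {n : ℕ∞} {V : Π y : M, TangentSpace (𝓡 4) y} {x : M}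
    (hV : ContMDiffAt (𝓡 4) (𝓡 4).tangent n (T% V) x) (a : Fin 4) :
    ContMDiffAt (𝓡 4) 𝓘(ℝ, ℝ) n (fun y ↦ F.coframe a y (V y)) x := by
  simp only [coframe_eq_metric]
  exact contMDiffAt_const.mul
    (contMDiffAt_metric hV (F.contMDiffAt_e n a x))

theorem mdifferentiableAt_e (a : Fin 4) (x : M) :
    MDifferentiableAt (𝓡 4) (𝓡 4).tangent (T% (F.e a)) x :=
  (F.smooth a x).mdifferentiableAt (by simp)

/-- The endomorphism field `v ↦ ∇_v e_a` is smooth. -/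
theorem contMDiff_conn_e (a : Fin 4) :
    ContMDiff (𝓡 4)
      ((𝓡 4).prod 𝓘(ℝ, EuclideanSpace ℝ (Fin 4) →L[ℝ] EuclideanSpace ℝ (Fin 4))) ∞
      (fun y ↦ TotalSpace.mk' (EuclideanSpace ℝ (Fin 4) →L[ℝ] EuclideanSpace ℝ (Fin 4))
        (E := fun y : M ↦ TangentSpace (𝓡 4) y →L[ℝ] TangentSpace (𝓡 4) y)
        y (S.conn (F.e a) y)) := by
  rw [← contMDiffOn_univ]
  exact S.conn_smooth.contMDiff (contMDiffOn_univ.2 (F.smooth a))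

theorem contMDiffAt_conn_e {n : ℕ∞} {V : Π y : M, TangentSpace (𝓡 4) y} {x : M}
    (hV : ContMDiffAt (𝓡 4) (𝓡 4).tangent n (T% V) x) (a : Fin 4) :
    ContMDiffAt (𝓡 4) (𝓡 4).tangent n (T% (fun y ↦ S.conn (F.e a) y (V y))) x :=
  ContMDiffAt.clm_bundle_apply (F₁ := EuclideanSpace ℝ (Fin 4)) (F₂ := EuclideanSpace ℝ (Fin 4))
    ((F.contMDiff_conn_e a x).of_le (by exact_mod_cast le_top)) hV

theorem mdifferentiableAt_conn_e {V : Π y : M, TangentSpace (𝓡 4) y} {x : M}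
    (hV : MDifferentiableAt (𝓡 4) (𝓡 4).tangent (T% V) x) (a : Fin 4) :
    MDifferentiableAt (𝓡 4) (𝓡 4).tangent (T% (fun y ↦ S.conn (F.e a) y (V y))) x :=
  MDifferentiableAt.clm_bundle_apply (F₁ := EuclideanSpace ℝ (Fin 4))
    (F₂ := EuclideanSpace ℝ (Fin 4))
    ((F.contMDiff_conn_e a x).mdifferentiableAt (by simp)) hV

/-- The connection coefficients `G^a_{cb} = θ^a(∇_{e_b} e_c)`; the last index is the direction of
differentiation. -/
noncomputable def coeff (a c b : Fin 4) (x : M) : ℝ := F.omega a c x (F.e b x)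

theorem mdifferentiableAt_coeff (a c b : Fin 4) (x : M) :
    MDifferentiableAt (𝓡 4) 𝓘(ℝ, ℝ) (F.coeff a c b) x :=
  (F.contMDiffAt_coframe (n := ⊤) (F.contMDiffAt_conn_e (n := ⊤) (F.smooth b x) c)
    a).mdifferentiableAt (by simp)

/-- The derivative `e_c(G^a_{db})` of a connection coefficient. -/
noncomputable def dcoeff (c a d b : Fin 4) (x : M) : ℝ := mvfderiv (𝓡 4) (F.coeff a d b) x (F.e c x)

theorem conn_e_e (b c : Fin 4) (x : M) :
    S.conn (F.e c) x (F.e b x) = ∑ a, F.coeff a c b x • F.e a x :=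
  (F.sum_coframe_smul x _).symm

/-- Metric compatibility: `ω_{ab}(v) = η_{ac} ω^c_b(v)` is antisymmetric in `a` and `b`. -/
theorem omega_antisymm (a b : Fin 4) (x : M) (v : TangentSpace (𝓡 4) x) :
    minkowski a * F.omega a b x v = -(minkowski b * F.omega b a x v) := by
  have h := S.conn_metric x (F.e a) (F.e b) (F.mdifferentiableAt_e a x)
    (F.mdifferentiableAt_e b x) v
  simp only [F.orthonormal, mvfderiv_const, S.metric_symm x (F.e a x), metric_e_right] at h
  simp only [omega]
  rw [zero_apply] at h
  linarith

theorem coeff_antisymm (a b c : Fin 4) (x : M) :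
    minkowski a * F.coeff a b c x = -(minkowski b * F.coeff b a c x) :=
  F.omega_antisymm a b x _

/-- The antisymmetry of the connection coefficients, with the metric at the second index. -/
theorem coeff_antisymm_right (a b c : Fin 4) (x : M) :
    minkowski b * F.coeff a b c x = -(minkowski a * F.coeff b a c x) := by
  linear_combination minkowski a * minkowski b * F.coeff_antisymm a b c x
    - minkowski b * F.coeff a b c x * minkowski_mul_self a
    - minkowski a * F.coeff b a c x * minkowski_mul_self b

theorem dcoeff_antisymm (d a b c : Fin 4) (x : M) :
    minkowski a * F.dcoeff d a b c x = -(minkowski b * F.dcoeff d b a c x) := by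
  have h : F.coeff a b c = fun y ↦ -(minkowski a * minkowski b) * F.coeff b a c y := by
    funext y
    linear_combination minkowski a * F.coeff_antisymm a b c y
      - F.coeff a b c y * minkowski_mul_self a
  have h' : F.dcoeff d a b c x = -(minkowski a * minkowski b) * F.dcoeff d b a c x := by
    simp only [dcoeff]
    rw [h]
    exact mvfderiv_const_mul _ (F.mdifferentiableAt_coeff b a c x) _
  rw [h']
  linear_combination -(minkowski b * F.dcoeff d b a c x) * minkowski_mul_self a

end Tetrad

end LorentzianSpacetime

/-! ### The curvature in a tetrad -/

namespace LorentzianSpacetime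

variable {M : Type*} [TopologicalSpace M] [ChartedSpace (EuclideanSpace ℝ (Fin 4)) M]
  [IsManifold (𝓡 4) ∞ M] {S : LorentzianSpacetime M}

theorem conn_congr {V W : Π y : M, TangentSpace (𝓡 4) y} {x : M}
    (hV : MDifferentiableAt (𝓡 4) (𝓡 4).tangent (T% V) x) (h : ∀ᶠ y in 𝓝 x, W y = V y) :
    S.conn W x = S.conn V x := by
  refine S.conn.isCovariantDerivativeOnUniv.congr_of_eventuallyEq ?_ hV univ_mem h
  exact hV.congr_of_eventuallyEq (h.mono fun y hy ↦ by simp [hy])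

theorem conn_add {V W : Π y : M, TangentSpace (𝓡 4) y} {x : M}
    (hV : MDifferentiableAt (𝓡 4) (𝓡 4).tangent (T% V) x)
    (hW : MDifferentiableAt (𝓡 4) (𝓡 4).tangent (T% W) x) :
    S.conn (V + W) x = S.conn V x + S.conn W x :=
  S.conn.isCovariantDerivativeOnUniv.add hV hW

theorem conn_smul {f : M → ℝ} {V : Π y : M, TangentSpace (𝓡 4) y} {x : M}
    (hf : MDifferentiableAt (𝓡 4) 𝓘(ℝ, ℝ) f x)
    (hV : MDifferentiableAt (𝓡 4) (𝓡 4).tangent (T% V) x) (v : TangentSpace (𝓡 4) x) :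
    S.conn (f • V) x v = f x • S.conn V x v + mvfderiv (𝓡 4) f x v • V x := by
  rw [S.conn.isCovariantDerivativeOnUniv.leibniz hV hf]
  rfl

theorem conn_sum {ι : Type*} (s : Finset ι) {V : ι → Π y : M, TangentSpace (𝓡 4) y} {x : M}
    (hV : ∀ i ∈ s, MDifferentiableAt (𝓡 4) (𝓡 4).tangent (T% (V i)) x) :
    S.conn (fun y ↦ ∑ i ∈ s, V i y) x = ∑ i ∈ s, S.conn (V i) x := by
  classical
  induction s using Finset.induction_on with
  | empty =>
    simp only [Finset.sum_empty]
    exact S.conn.isCovariantDerivativeOnUniv.zero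
  | insert a s ha ih =>
    rw [Finset.forall_mem_insert] at hV
    simp only [Finset.sum_insert ha, ← ih hV.2]
    exact conn_add hV.1 (.sum_section hV.2)

theorem mlieBracket_eq {U V : Π y : M, TangentSpace (𝓡 4) y} {x : M}
    (hU : MDifferentiableAt (𝓡 4) (𝓡 4).tangent (T% U) x)
    (hV : MDifferentiableAt (𝓡 4) (𝓡 4).tangent (T% V) x) :
    mlieBracket (𝓡 4) U V x = S.conn V x (U x) - S.conn U x (V x) :=
  (S.conn.torsion_eq_zero_iff.1 S.conn_torsion hU hV).symm

namespace Tetrad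

variable (F : S.Tetrad)

/-- The curvature `R(U, V) e_k` at `x` of vector fields `U` and `V`. -/
noncomputable def curvatureField (k : Fin 4) (x : M) (U V : Π y : M, TangentSpace (𝓡 4) y) :
    TangentSpace (𝓡 4) x :=
  S.conn (fun y ↦ S.conn (F.e k) y (V y)) x (U x) - S.conn (fun y ↦ S.conn (F.e k) y (U y)) x (V x)
    - S.conn (F.e k) x (mlieBracket (𝓡 4) U V x)

theorem curvatureField_swap (k : Fin 4) (x : M) (U V : Π y : M, TangentSpace (𝓡 4) y) :
    F.curvatureField k x U V = -F.curvatureField k x V U := by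
  simp only [curvatureField]
  rw [mlieBracket_swap_apply, map_neg]
  abel

theorem tensorialAt_curvatureField_left (k : Fin 4) (x : M) (V : Π y : M, TangentSpace (𝓡 4) y)
    (_ : MDifferentiableAt (𝓡 4) (𝓡 4).tangent (T% V) x) :
    TensorialAt (𝓡 4) (EuclideanSpace ℝ (Fin 4)) (F.curvatureField k x · V) x where
  smul {f U} hf hU := by
    have h : (fun y ↦ S.conn (F.e k) y ((f • U) y)) = f • fun y ↦ S.conn (F.e k) y (U y) := by
      funext y; simp
    simp only [curvatureField]
    rw [h, conn_smul hf (F.mdifferentiableAt_conn_e hU k), mlieBracket_smul_left hf hU]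
    simp only [Pi.smul_apply', map_smul, map_add]
    module
  add {U U'} hU hU' := by
    have h : (fun y ↦ S.conn (F.e k) y ((U + U') y))
        = (fun y ↦ S.conn (F.e k) y (U y)) + fun y ↦ S.conn (F.e k) y (U' y) := by
      funext y; simp
    simp only [curvatureField]
    rw [h, conn_add (F.mdifferentiableAt_conn_e hU k) (F.mdifferentiableAt_conn_e hU' k),
      mlieBracket_add_left hU hU']
    simp only [Pi.add_apply, map_add, add_apply]
    abel

theorem tensorialAt_curvatureField_right (k : Fin 4) (x : M) (U : Π y : M, TangentSpace (𝓡 4) y)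
    (hU : MDifferentiableAt (𝓡 4) (𝓡 4).tangent (T% U) x) :
    TensorialAt (𝓡 4) (EuclideanSpace ℝ (Fin 4)) (F.curvatureField k x U) x where
  smul hf hV := by
    simp only [F.curvatureField_swap k x U]
    rw [(F.tensorialAt_curvatureField_left k x U hU).smul hf hV, smul_neg]
  add hV hV' := by
    simp only [F.curvatureField_swap k x U]
    rw [(F.tensorialAt_curvatureField_left k x U hU).add hV hV', neg_add]

/-- The curvature `R(u, v) e_k` at `x`, as a bilinear function of tangent vectors. -/
noncomputable def curvature (k : Fin 4) (x : M) :
    TangentSpace (𝓡 4) x →L[ℝ] TangentSpace (𝓡 4) x →L[ℝ] TangentSpace (𝓡 4) x :=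
  TensorialAt.mkHom₂ (F.curvatureField k x) x (F.tensorialAt_curvatureField_left k x)
    (F.tensorialAt_curvatureField_right k x)

/-- `R(e_i, e_j) e_k` in terms of the connection coefficients. -/
theorem coframe_curvature (m k i j : Fin 4) (x : M) :
    F.coframe m x (F.curvature k x (F.e i x) (F.e j x))
      = F.dcoeff i m k j x - F.dcoeff j m k i x
        + ∑ l, (F.coeff l k j x * F.coeff m l i x - F.coeff l k i x * F.coeff m l j x)
        - ∑ l, (F.coeff l j i x - F.coeff l i j x) * F.coeff m k l x := by
  have h2 : ∀ i j, F.coframe m x (S.conn (fun y ↦ S.conn (F.e k) y (F.e j y)) x (F.e i x))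
      = F.dcoeff i m k j x + ∑ l, F.coeff l k j x * F.coeff m l i x := by
    intro i j
    have h : (fun y ↦ S.conn (F.e k) y (F.e j y)) = fun y ↦ ∑ l, (F.coeff l k j • F.e l) y := by
      funext y
      exact F.conn_e_e j k y
    rw [h, conn_sum]
    · rw [sum_apply, map_sum]
      simp only [conn_smul (F.mdifferentiableAt_coeff _ _ _ x) (F.mdifferentiableAt_e _ x)]
      simp [Finset.sum_add_distrib, dcoeff, coeff, omega, add_comm]
    · exact fun l _ ↦ (F.mdifferentiableAt_coeff _ _ _ x).smul_section (F.mdifferentiableAt_e _ x)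
  have h3 : F.coframe m x (S.conn (F.e k) x (mlieBracket (𝓡 4) (F.e i) (F.e j) x))
      = ∑ l, (F.coeff l j i x - F.coeff l i j x) * F.coeff m k l x := by
    rw [mlieBracket_eq (S := S) (F.mdifferentiableAt_e i x) (F.mdifferentiableAt_e j x),
      F.conn_e_e, F.conn_e_e, ← Finset.sum_sub_distrib]
    simp [← sub_smul, coeff, omega]
  rw [curvature, TensorialAt.mkHom₂_apply _ _ (F.mdifferentiableAt_e i x)
    (F.mdifferentiableAt_e j x), curvatureField, map_sub, map_sub, h2, h2, h3,
    Finset.sum_sub_distrib]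
  ring

include F in
/-- The bracket `[V, f e_0] = V(f) e_0 + f [V, e_0]` exhibits `V(f)` as a component of a
differentiable vector field. -/
theorem mdifferentiableAt_mvfderiv {f : M → ℝ} {V : Π y : M, TangentSpace (𝓡 4) y} {x : M}
    (hf : ContMDiffAt (𝓡 4) 𝓘(ℝ, ℝ) 2 f x) (hV : ContMDiffAt (𝓡 4) (𝓡 4).tangent 2 (T% V) x) :
    MDifferentiableAt (𝓡 4) 𝓘(ℝ, ℝ) (fun y ↦ mvfderiv (𝓡 4) f y (V y)) x := by
  have : IsManifold (𝓡 4) (minSmoothness ℝ 2) M := by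
    rw [minSmoothness_of_isRCLikeNormedField]; infer_instance
  have : IsManifold (𝓡 4) ((2 : ℕ∞) + 1) M := inferInstanceAs (IsManifold (𝓡 4) 3 M)
  have he : ContMDiffAt (𝓡 4) (𝓡 4).tangent 2 (T% (F.e 0)) x :=
    F.contMDiffAt_e 2 0 x
  have hbr : ∀ {Y : Π y : M, TangentSpace (𝓡 4) y},
      ContMDiffAt (𝓡 4) (𝓡 4).tangent 2 (T% Y) x →
      MDifferentiableAt (𝓡 4) 𝓘(ℝ, ℝ) (fun y ↦ F.coframe 0 y (mlieBracket (𝓡 4) V Y y)) x := by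
    intro Y hY
    have h := ContMDiffAt.mlieBracket_vectorField (m := 1) (n := 2) hV hY (by
      rw [minSmoothness_of_isRCLikeNormedField]; norm_num)
    exact (F.contMDiffAt_coframe (n := 1) h 0).mdifferentiableAt one_ne_zero
  refine ((hbr (hf.smul_section he)).sub
    ((hf.mdifferentiableAt two_ne_zero).mul (hbr he))).congr_of_eventuallyEq ?_
  filter_upwards [(hf.of_le one_le_two).eventually_mdifferentiableAt] with y hfy
  have h := mlieBracket_smul_right (V := V) hfy (F.mdifferentiableAt_e 0 y)
  simp [h]

/-- The curvature is tensorial in its last argument: the first derivatives of the components of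
the extension of `w` occur symmetrically in `u` and `v`, and the second derivatives cancel against
the bracket term. -/
theorem riemann_eq (x : M) (u v w : TangentSpace (𝓡 4) x) :
    S.riemann x u v w = ∑ k, F.coframe k x w • F.curvature k x u v := by
  have hext : ∀ z : TangentSpace (𝓡 4) x, ContMDiffAt (𝓡 4) (𝓡 4).tangent 2
      (T% (FiberBundle.extend (EuclideanSpace ℝ (Fin 4)) z : Π y : M, TangentSpace (𝓡 4) y)) x :=
    fun z ↦ FiberBundle.contMDiffAt_extend ..
  have hU := hext u
  have hV := hext v
  have hW := hext w
  have hUx : (FiberBundle.extend (EuclideanSpace ℝ (Fin 4)) u : Π y : M, TangentSpace (𝓡 4) y) x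
    = u := FiberBundle.extend_apply_self ..
  have hVx : (FiberBundle.extend (EuclideanSpace ℝ (Fin 4)) v : Π y : M, TangentSpace (𝓡 4) y) x
    = v := FiberBundle.extend_apply_self ..
  have hWx : (FiberBundle.extend (EuclideanSpace ℝ (Fin 4)) w : Π y : M, TangentSpace (𝓡 4) y) x
    = w := FiberBundle.extend_apply_self ..
  rw [riemann]
  set U : Π y : M, TangentSpace (𝓡 4) y := FiberBundle.extend (EuclideanSpace ℝ (Fin 4)) u
  set V : Π y : M, TangentSpace (𝓡 4) y := FiberBundle.extend (EuclideanSpace ℝ (Fin 4)) v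
  set W : Π y : M, TangentSpace (𝓡 4) y := FiberBundle.extend (EuclideanSpace ℝ (Fin 4)) w
  -- the components of `W`
  set f : Fin 4 → M → ℝ := fun k y ↦ F.coframe k y (W y) with hf_def
  have hf : ∀ k, ContMDiffAt (𝓡 4) 𝓘(ℝ, ℝ) 2 (f k) x :=
    fun k ↦ F.contMDiffAt_coframe (n := 2) hW k
  have hf1 : ∀ k, MDifferentiableAt (𝓡 4) 𝓘(ℝ, ℝ) (f k) x :=
    fun k ↦ (hf k).mdifferentiableAt two_ne_zero
  have hWf : W = fun y ↦ ∑ k, (f k • F.e k) y := by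
    funext y
    exact (F.sum_coframe_smul y (W y)).symm
  have hcW : ∀ᶠ y in 𝓝 x, ∀ z : TangentSpace (𝓡 4) y, S.conn W y z
      = ∑ k, (f k y • S.conn (F.e k) y z + mvfderiv (𝓡 4) (f k) y z • F.e k y) := by
    have h := eventually_all.2
      fun k ↦ ((hf k).of_le one_le_two).eventually_mdifferentiableAt
    filter_upwards [h] with y hy z
    rw [hWf, conn_sum _ fun k _ ↦ (hy k).smul_section (F.mdifferentiableAt_e k y), sum_apply]
    exact Finset.sum_congr rfl fun k _ ↦ conn_smul (hy k) (F.mdifferentiableAt_e k y) z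
  have hccW : ∀ {Y : Π y : M, TangentSpace (𝓡 4) y} (z : TangentSpace (𝓡 4) x),
      ContMDiffAt (𝓡 4) (𝓡 4).tangent 2 (T% Y) x →
      S.conn (fun y ↦ S.conn W y (Y y)) x z
        = ∑ k, ((f k x • S.conn (fun y ↦ S.conn (F.e k) y (Y y)) x z
            + mvfderiv (𝓡 4) (f k) x z • S.conn (F.e k) x (Y x))
          + (mvfderiv (𝓡 4) (f k) x (Y x) • S.conn (F.e k) x z
            + mvfderiv (𝓡 4) (fun y ↦ mvfderiv (𝓡 4) (f k) y (Y y)) x z • F.e k x)) := by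
    intro Y z hY
    have hA := fun k ↦ F.mdifferentiableAt_conn_e (hY.mdifferentiableAt two_ne_zero) k
    have hD := fun k ↦ F.mdifferentiableAt_mvfderiv (hf k) hY
    have h1 := fun k ↦ (hf1 k).smul_section (hA k)
    have h2 := fun k ↦ (hD k).smul_section (F.mdifferentiableAt_e k x)
    have h12 := fun k ↦ mdifferentiableAt_add_section (h1 k) (h2 k)
    rw [conn_congr (S := S) (.sum_section fun k _ ↦ h12 k) (hcW.mono fun y hy ↦ hy (Y y)),
      conn_sum _ fun k _ ↦ h12 k, sum_apply]
    refine Finset.sum_congr rfl fun k _ ↦ ?_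
    rw [conn_add (h1 k) (h2 k), add_apply, conn_smul (hf1 k) (hA k),
      conn_smul (hD k) (F.mdifferentiableAt_e k x)]
  have he0 : ∀ k, F.e k x ≠ 0 := fun k h ↦ by simpa [h] using F.coframe_e k k x
  have hbr := fun k ↦ mvfderiv_mlieBracket_apply (hf k) hU hV
    (F.contMDiffAt_e 2 k x) (he0 k)
    (F.mdifferentiableAt_mvfderiv (hf k) hU) (F.mdifferentiableAt_mvfderiv (hf k) hV)
  have hcurv : ∀ k, F.curvature k x u v = F.curvatureField k x U V :=
    fun k ↦ TensorialAt.mkHom₂_apply_eq_extend _ _ u v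
  have hfw : ∀ k, F.coframe k x w = f k x := fun k ↦ by rw [hf_def]; simp only [hWx]
  rw [hccW u hV, hccW v hU, hcW.self_of_nhds, ← Finset.sum_sub_distrib, ← Finset.sum_sub_distrib]
  refine Finset.sum_congr rfl fun k _ ↦ ?_
  rw [hfw, hcurv, curvatureField, ← hbr, hUx, hVx]
  module

end Tetrad

end LorentzianSpacetime

/-! ### The Clifford connection in a tetrad -/

namespace LorentzianSpacetime

variable {M : Type*} [TopologicalSpace M] [ChartedSpace (EuclideanSpace ℝ (Fin 4)) M]
  [IsManifold (𝓡 4) ∞ M] {S : LorentzianSpacetime M}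

theorem ofCovector_injective (x : M) : Function.Injective (S.ofCovector (x := x)) := by
  intro α β h
  have h' := congrArg (CliffordAlgebra.equivExterior (S.coform x)) h
  simp only [ofCovector, CliffordAlgebra.equivExterior, CliffordAlgebra.changeFormEquiv_apply,
    CliffordAlgebra.changeForm_ι] at h'
  exact (ExteriorAlgebra.ι_inj ℝ α β).1 h'

theorem bilin_apply (x : M) (u v : TangentSpace (𝓡 4) x) : S.bilin x u v = S.metric x u v := rfl

namespace Tetrad

variable (F : S.Tetrad)

theorem sharp_coframe (a : Fin 4) (x : M) :
    S.sharp x (F.coframe a x) = minkowski a • F.e a x := by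
  rw [sharp, LinearEquiv.symm_apply_eq]
  refine F.covector_ext fun b ↦ ?_
  rw [LinearMap.BilinForm.toDual_def]
  rw [map_smul, LinearMap.smul_apply, bilin_apply, F.orthonormal, coframe_e, eta, smul_eq_mul]
  split_ifs <;> simp [minkowski_mul_self]

theorem cometric_coframe (a b : Fin 4) (x : M) :
    S.cometric x (F.coframe a x) (F.coframe b x) = eta a b := by
  simp only [cometric, LinearMap.compl₁₂_apply, LinearEquiv.coe_coe, sharp_coframe, map_smul,
    LinearMap.smul_apply, bilin_apply, F.orthonormal, eta, smul_eq_mul]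
  split_ifs with h
  · rw [h, minkowski_mul_self, mul_one]
  · simp

/-- The field of multiforms with constant components in the bases generated by the cotetrad: the
image of a fixed `A` in the exterior algebra of `ℝ⁴` under `ℝ⁴ ≃ T_x^* M`. -/
noncomputable def constForm (A : ExteriorAlgebra ℝ (Fin 4 → ℝ)) : S.CliffField := fun x ↦
  (CliffordAlgebra.equivExterior (S.coform x)).symm
    (ExteriorAlgebra.map (F.cobasis x).equivFun.symm.toLinearMap A)

/-- The components of `constForm A` do not depend on the point: this is why `frameDeriv`
differentiates only the coefficients of a combination of such fields. -/
theorem cliffBasis_repr_constForm (A : ExteriorAlgebra ℝ (Fin 4 → ℝ)) (x : M) :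
    (F.cliffBasis x).repr (F.constForm A x) = (Pi.basisFun ℝ (Fin 4)).ExteriorAlgebra.repr A := by
  let b := (Pi.basisFun ℝ (Fin 4)).ExteriorAlgebra
  have h : ((F.cliffBasis x).repr.toLinearMap ∘ₗ
      (CliffordAlgebra.equivExterior (S.coform x)).symm.toLinearMap) ∘ₗ
      (ExteriorAlgebra.map (F.cobasis x).equivFun.symm.toLinearMap).toLinearMap
      = b.repr.toLinearMap := by
    refine b.ext fun s ↦ ?_
    have hs : ExteriorAlgebra.map (F.cobasis x).equivFun.symm.toLinearMap (b s)
        = (F.cobasis x).ExteriorAlgebra s := by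
      rw [ExteriorAlgebra.basis_apply, ExteriorAlgebra.basis_apply]
      simp only [ExteriorAlgebra.ιMulti_family, ExteriorAlgebra.map_apply_ιMulti]
      congr 1
      funext i
      simp
    simp only [LinearMap.comp_apply, AlgHom.toLinearMap_apply, LinearEquiv.coe_coe, hs]
    rw [Basis.repr_self, cliffBasis, Basis.map_repr, LinearEquiv.trans_apply,
      LinearEquiv.symm_apply_apply, Basis.repr_self]
  exact LinearMap.congr_fun h A

theorem constForm_one : F.constForm 1 = fun _ ↦ 1 := by
  funext x
  rw [constForm, map_one, LinearEquiv.symm_apply_eq]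
  simp [CliffordAlgebra.equivExterior]

theorem equivExterior_theta (a : Fin 4) (x : M) :
    CliffordAlgebra.equivExterior (S.coform x) (F.theta a x)
      = ExteriorAlgebra.ι ℝ (F.coframe a x) := by
  simp only [theta, ofCovector, CliffordAlgebra.equivExterior,
    CliffordAlgebra.changeFormEquiv_apply, CliffordAlgebra.changeForm_ι]

theorem map_ι_single (a : Fin 4) (x : M) :
    ExteriorAlgebra.map (F.cobasis x).equivFun.symm.toLinearMap
      (ExteriorAlgebra.ι ℝ (Pi.single a 1)) = ExteriorAlgebra.ι ℝ (F.coframe a x) := by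
  rw [ExteriorAlgebra.map_apply_ι, coframe]
  simp

theorem constForm_ι (a : Fin 4) :
    F.constForm (ExteriorAlgebra.ι ℝ (Pi.single a 1)) = F.theta a := by
  funext x
  rw [constForm, LinearEquiv.symm_apply_eq, equivExterior_theta, map_ι_single]

theorem constForm_ι_mul_ι (a b : Fin 4) :
    F.constForm (ExteriorAlgebra.ι ℝ (Pi.single a 1) * ExteriorAlgebra.ι ℝ (Pi.single b 1))
      = fun x ↦ S.wedge (F.coframe a x) (F.theta b x) := by
  funext x
  rw [constForm, wedge, equivExterior_theta, map_mul, map_ι_single, map_ι_single]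

theorem contract_theta (a b : Fin 4) (x : M) :
    S.contract (F.coframe a x) (F.theta b x) = eta a b • 1 := by
  rw [contract, theta, ofCovector, CliffordAlgebra.contractLeft_ι, cometric_coframe,
    Algebra.algebraMap_eq_smul_one]

theorem theta_mul_theta (a b : Fin 4) (x : M) :
    F.theta a x * F.theta b x = S.wedge (F.coframe a x) (F.theta b x) + eta a b • 1 := by
  rw [← F.contract_theta, ← ofCovector_mul]
  rfl

theorem contract_theta_mul_theta (a b c : Fin 4) (x : M) :
    S.contract (F.coframe a x) (F.theta b x * F.theta c x)
      = eta a b • F.theta c x - eta a c • F.theta b x := by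
  have h := F.contract_theta a c x
  simp only [contract, theta, ofCovector] at h ⊢
  rw [CliffordAlgebra.contractLeft_ι_mul, cometric_coframe, h, mul_smul_comm, mul_one]

theorem theta_mul_theta_swap (a b : Fin 4) (x : M) :
    F.theta b x * F.theta a x = (2 * eta a b) • 1 - F.theta a x * F.theta b x := by
  have h := CliffordAlgebra.ι_mul_ι_add_swap (Q := S.coform x) (F.coframe a x) (F.coframe b x)
  have hp : QuadraticMap.polar (S.coform x) (F.coframe a x) (F.coframe b x) = 2 * eta a b := by
    have hs : eta b a = eta a b := by
      simp only [eta, eq_comm (a := b)]; split_ifs with h <;> simp [h]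
    simp only [coform, LinearMap.BilinMap.polar_toQuadraticMap, cometric_coframe, hs]
    ring
  rw [hp, Algebra.algebraMap_eq_smul_one] at h
  rw [← h]
  simp [theta, ofCovector]

/-- The commutator `½ [ω_v, A]`. -/
noncomputable def connBracket (x : M) (v : TangentSpace (𝓡 4) x) (A : S.Cliff x) : S.Cliff x :=
  (1 / 2 : ℝ) • (F.connForm x v * A - A * F.connForm x v)

theorem connBracket_mul (x : M) (v : TangentSpace (𝓡 4) x) (A B : S.Cliff x) :
    F.connBracket x v (A * B) = F.connBracket x v A * B + A * F.connBracket x v B := by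
  simp only [connBracket, smul_mul_assoc, mul_smul_comm, ← smul_add]
  congr 1
  noncomm_ring

theorem connBracket_sum {ι : Type*} (s : Finset ι) (x : M) (v : TangentSpace (𝓡 4) x)
    (f : ι → ℝ) (A : ι → S.Cliff x) :
    F.connBracket x v (∑ i ∈ s, f i • A i) = ∑ i ∈ s, f i • F.connBracket x v (A i) := by
  simp only [connBracket, Finset.mul_sum, Finset.sum_mul, ← Finset.sum_sub_distrib,
    Finset.smul_sum, mul_smul_comm, smul_mul_assoc, ← smul_sub]
  exact Finset.sum_congr rfl fun i _ ↦ smul_comm _ _ _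

theorem connBracket_one (x : M) (v : TangentSpace (𝓡 4) x) : F.connBracket x v 1 = 0 := by
  simp [connBracket]

/-- The Clifford connection restricts to the Levi-Civita connection on covectors. -/
theorem connBracket_theta (a : Fin 4) (x : M) (v : TangentSpace (𝓡 4) x) :
    F.connBracket x v (F.theta a x) = ∑ d, (-F.omega a d x v) • F.theta d x := by
  have hcomm : ∀ b c, (F.theta b x * F.theta c x) * F.theta a x
      - F.theta a x * (F.theta b x * F.theta c x)
      = (2 * eta a c) • F.theta b x - (2 * eta a b) • F.theta c x := by
    intro b c
    rw [mul_assoc, F.theta_mul_theta_swap a c, mul_sub, ← mul_assoc, ← mul_assoc,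
      F.theta_mul_theta_swap a b, sub_mul]
    simp only [mul_smul_comm, smul_mul_assoc, mul_one, one_mul]
    abel
  have hb : F.connForm x v * F.theta a x - F.theta a x * F.connForm x v
      = (1 / 2 : ℝ) • ∑ b, ∑ c, (F.omega b c x v * minkowski b) •
        ((2 * eta a c) • F.theta b x - (2 * eta a b) • F.theta c x) := by
    simp only [connForm, smul_mul_assoc, mul_smul_comm, Finset.sum_mul, Finset.mul_sum,
      ← smul_sub, ← Finset.sum_sub_distrib, hcomm, smul_smul]
    congr 1
    refine Finset.sum_congr rfl fun b _ ↦ Finset.sum_congr rfl fun c _ ↦ ?_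
    congr 1
    linear_combination (F.omega b c x v * minkowski b) * minkowski_mul_self c
  rw [connBracket, hb]
  simp only [smul_sub, Finset.sum_sub_distrib, eta, mul_ite, mul_zero, ite_smul, smul_ite,
    zero_smul, smul_zero]
  rw [Finset.sum_comm (f := fun b c ↦ if a = b then _ else _)]
  simp only [Finset.sum_ite_eq, Finset.mem_univ, if_true, Finset.smul_sum, smul_smul,
    ← Finset.sum_sub_distrib, ← sub_smul]
  refine Finset.sum_congr rfl fun d _ ↦ ?_
  congr 1
  linear_combination (1 / 2 * minkowski a) * F.omega_antisymm d a x v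
    - F.omega a d x v * minkowski_mul_self a

/-- The covariant derivative of a combination of multiforms with constant components. -/
theorem covDeriv_sum {ι : Type*} [Fintype ι] {f : ι → M → ℝ}
    {A : ι → ExteriorAlgebra ℝ (Fin 4 → ℝ)} {x : M}
    (hf : ∀ i, MDifferentiableAt (𝓡 4) 𝓘(ℝ, ℝ) (f i) x) (v : TangentSpace (𝓡 4) x) :
    F.covDeriv (fun y ↦ ∑ i, f i y • F.constForm (A i) y) x v
      = ∑ i, (mvfderiv (𝓡 4) (f i) x v • F.constForm (A i) x
        + f i x • F.connBracket x v (F.constForm (A i) x)) := by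
  have hd : F.frameDeriv (fun y ↦ ∑ i, f i y • F.constForm (A i) y) x v
      = ∑ i, mvfderiv (𝓡 4) (f i) x v • F.constForm (A i) x := by
    have hr : ∀ s, mvfderiv (𝓡 4) (fun y ↦ (F.cliffBasis y).repr
        (∑ i, f i y • F.constForm (A i) y) s) x v
        = ∑ i, mvfderiv (𝓡 4) (f i) x v * (F.cliffBasis x).repr (F.constForm (A i) x) s := by
      intro s
      simp only [map_sum, map_smul, Finsupp.coe_finsetSum, Finset.sum_apply, Finsupp.smul_apply,
        smul_eq_mul, cliffBasis_repr_constForm]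
      simp only [mul_comm (f _ _)]
      rw [mvfderiv_finsetSum (f := fun i y ↦ _ * f i y) _
        fun i _ ↦ mdifferentiableAt_const.mul (hf i), sum_apply]
      exact Finset.sum_congr rfl fun i _ ↦ by rw [mvfderiv_const_mul _ (hf i), mul_comm]
    rw [frameDeriv]
    simp only [hr, Finset.sum_smul, mul_smul]
    rw [Finset.sum_comm]
    exact Finset.sum_congr rfl fun i _ ↦ by
      rw [← Finset.smul_sum, (F.cliffBasis x).sum_repr]
  rw [Finset.sum_add_distrib, ← hd, ← connBracket_sum]
  rfl

end Tetrad

end LorentzianSpacetime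

/-! ### The second-order operators on the cotetrad -/

namespace LorentzianSpacetime

variable {M : Type*} [TopologicalSpace M] [ChartedSpace (EuclideanSpace ℝ (Fin 4)) M]
  [IsManifold (𝓡 4) ∞ M] {S : LorentzianSpacetime M}

theorem wedge_sum {ι : Type*} (s : Finset ι) {x : M} (α : Dual ℝ (TangentSpace (𝓡 4) x))
    (f : ι → ℝ) (A : ι → S.Cliff x) :
    S.wedge α (∑ i ∈ s, f i • A i) = ∑ i ∈ s, f i • S.wedge α (A i) := by
  simp only [wedge, map_sum, map_smul, Finset.mul_sum, mul_smul_comm]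

theorem contract_sum {ι : Type*} (s : Finset ι) {x : M} (α : Dual ℝ (TangentSpace (𝓡 4) x))
    (f : ι → ℝ) (A : ι → S.Cliff x) :
    S.contract α (∑ i ∈ s, f i • A i) = ∑ i ∈ s, f i • S.contract α (A i) := by
  simp only [contract, map_sum, map_smul]

namespace Tetrad

variable (F : S.Tetrad)

theorem connBracket_theta_e (a b : Fin 4) (x : M) :
    F.connBracket x (F.e b x) (F.theta a x) = ∑ d, (-F.coeff a d b x) • F.theta d x :=
  F.connBracket_theta a x _

theorem nabla_sum {ι : Type*} [Fintype ι] {f : ι → M → ℝ}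
    {A : ι → ExteriorAlgebra ℝ (Fin 4 → ℝ)} {x : M}
    (hf : ∀ i, MDifferentiableAt (𝓡 4) 𝓘(ℝ, ℝ) (f i) x) (c : Fin 4) :
    F.nabla c (fun y ↦ ∑ i, f i y • F.constForm (A i) y) x
      = ∑ i, (mvfderiv (𝓡 4) (f i) x (F.e c x) • F.constForm (A i) x
        + f i x • F.connBracket x (F.e c x) (F.constForm (A i) x)) :=
  F.covDeriv_sum hf _

theorem nabla_theta (a b : Fin 4) :
    F.nabla b (F.theta a) = fun x ↦ ∑ d, (-F.coeff a d b x) • F.theta d x := by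
  funext x
  have h := F.nabla_sum (f := fun (_ : Unit) _ ↦ 1)
    (A := fun _ ↦ ExteriorAlgebra.ι ℝ (Pi.single a 1)) (x := x)
    (fun _ ↦ mdifferentiableAt_const) b
  simpa [constForm_ι, mvfderiv_const, connBracket_theta_e] using h

theorem mvfderiv_neg_coeff (c a d b : Fin 4) (x : M) :
    mvfderiv (𝓡 4) (fun y ↦ -F.coeff a d b y) x (F.e c x) = -F.dcoeff c a d b x := by
  have h := mvfderiv_const_mul (-1) (F.mdifferentiableAt_coeff a d b x) (F.e c x)
  simpa [dcoeff] using h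

theorem nabla_nabla_theta (a b c : Fin 4) (x : M) :
    F.nabla c (F.nabla b (F.theta a)) x
      = ∑ d, (-F.dcoeff c a d b x + ∑ k, F.coeff a k b x * F.coeff k d c x) • F.theta d x := by
  have h := F.nabla_sum (f := fun d y ↦ -F.coeff a d b y)
    (A := fun d ↦ ExteriorAlgebra.ι ℝ (Pi.single d 1)) (x := x)
    (fun d ↦ (F.mdifferentiableAt_coeff a d b x).neg) c
  simp only [constForm_ι, mvfderiv_neg_coeff, connBracket_theta_e] at h
  rw [nabla_theta, h, Finset.sum_add_distrib]
  simp only [add_smul, Finset.sum_add_distrib, Finset.smul_sum, smul_smul, neg_mul_neg,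
    Finset.sum_smul]
  congr 1
  exact Finset.sum_comm

theorem dAlembertian_theta (a : Fin 4) (x : M) :
    F.dAlembertian (F.theta a) x = ∑ m, (∑ b, minkowski b * (-F.dcoeff b a m b x
      + ∑ k, F.coeff a k b x * F.coeff k m b x + ∑ c, F.coeff c b b x * F.coeff a m c x))
        • F.theta m x := by
  have hω : ∀ a b c, F.omega c b x (F.e a x) = F.coeff c b a x := fun _ _ _ ↦ rfl
  simp only [dAlembertian, eta, ite_smul, zero_smul, Finset.sum_ite_eq, Finset.mem_univ, if_true,
    nabla_nabla_theta, hω]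
  have h : ∀ b, ∑ d, (-F.dcoeff b a d b x + ∑ k, F.coeff a k b x * F.coeff k d b x) • F.theta d x
      - ∑ c, F.coeff c b b x • F.nabla c (F.theta a) x
      = ∑ m, (-F.dcoeff b a m b x + ∑ k, F.coeff a k b x * F.coeff k m b x
        + ∑ c, F.coeff c b b x * F.coeff a m c x) • F.theta m x := by
    intro b
    simp only [nabla_theta, Finset.smul_sum, smul_smul]
    rw [Finset.sum_comm, ← Finset.sum_sub_distrib]
    refine Finset.sum_congr rfl fun m _ ↦ ?_
    rw [← Finset.sum_smul, ← sub_smul]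
    simp only [mul_neg, Finset.sum_neg_distrib, sub_neg_eq_add]
  simp only [h, Finset.smul_sum, smul_smul, Finset.sum_smul]
  exact Finset.sum_comm

theorem diracContract_theta (a : Fin 4) :
    F.diracContract (F.theta a) = fun x ↦ (∑ b, (-minkowski b) * F.coeff a b b x) • 1 := by
  funext x
  simp only [diracContract, nabla_theta, contract_sum, contract_theta, eta, ite_smul, zero_smul,
    smul_ite, smul_zero, Finset.sum_ite_eq, Finset.mem_univ, if_true, Finset.sum_smul, smul_smul]
  exact Finset.sum_congr rfl fun b _ ↦ by congr 1; ring

theorem diracWedge_diracContract_theta (a : Fin 4) (x : M) :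
    F.diracWedge (F.diracContract (F.theta a)) x
      = ∑ m, (-∑ b, minkowski b * F.dcoeff m a b b x) • F.theta m x := by
  have h : ∀ c, F.nabla c (F.diracContract (F.theta a)) x
      = (-∑ b, minkowski b * F.dcoeff c a b b x) • 1 := by
    intro c
    have h := F.nabla_sum (f := fun b y ↦ (-minkowski b) * F.coeff a b b y) (A := fun _ ↦ 1)
      (x := x) (fun b ↦ mdifferentiableAt_const.mul (F.mdifferentiableAt_coeff a b b x)) c
    simp only [constForm_one, connBracket_one, smul_zero, add_zero, ← Finset.sum_smul] at h
    rw [diracContract_theta, h, ← Finset.sum_neg_distrib]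
    congr 1
    refine Finset.sum_congr rfl fun b _ ↦ ?_
    rw [mvfderiv_const_mul _ (F.mdifferentiableAt_coeff a b b x), dcoeff, neg_mul]
  have hw : ∀ c (r : ℝ), S.wedge (F.coframe c x) (r • 1) = r • F.theta c x := by
    intro c r
    rw [wedge, map_smul, mul_smul_comm, map_smul]
    congr 1
    rw [LinearEquiv.symm_apply_eq, equivExterior_theta]
    simp [CliffordAlgebra.equivExterior]
  simp only [diracWedge, h, hw]

theorem diracWedge_theta (a : Fin 4) :
    F.diracWedge (F.theta a) = fun x ↦ ∑ p : Fin 4 × Fin 4, (-F.coeff a p.2 p.1 x) •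
      F.constForm (ExteriorAlgebra.ι ℝ (Pi.single p.1 1) * ExteriorAlgebra.ι ℝ (Pi.single p.2 1))
        x := by
  funext x
  simp only [diracWedge, nabla_theta, wedge_sum, constForm_ι_mul_ι, Fintype.sum_prod_type]

/-- Computed with `θ^b ∧ θ^d = θ^b θ^d - η^{bd}`, since the commutator is a derivation of the
Clifford product and kills scalars. -/
theorem contract_connBracket_wedge (a b c d : Fin 4) (x : M) :
    S.contract (F.coframe c x) (F.connBracket x (F.e a x) (S.wedge (F.coframe b x) (F.theta d x)))
      = ∑ k, (-F.coeff b k a x) • (eta c k • F.theta d x - eta c d • F.theta k x)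
        + ∑ k, (-F.coeff d k a x) • (eta c b • F.theta k x - eta c k • F.theta b x) := by
  have h1 : S.wedge (F.coframe b x) (F.theta d x) = F.theta b x * F.theta d x - eta b d • 1 :=
    eq_sub_of_add_eq (F.theta_mul_theta b d x).symm
  have h2 : F.connBracket x (F.e a x) (F.theta b x * F.theta d x - eta b d • 1)
      = F.connBracket x (F.e a x) (F.theta b x * F.theta d x) := by
    simp only [connBracket, mul_sub, sub_mul, mul_smul_comm, smul_mul_assoc, mul_one, one_mul,
      sub_sub_sub_cancel_right]
  have h3 : ∀ A B : S.Cliff x, S.contract (F.coframe c x) (A + B)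
      = S.contract (F.coframe c x) A + S.contract (F.coframe c x) B :=
    fun A B ↦ map_add _ A B
  rw [h1, h2, connBracket_mul, h3, connBracket_theta_e, connBracket_theta_e]
  simp only [Finset.sum_mul, Finset.mul_sum, smul_mul_assoc, mul_smul_comm, contract_sum,
    contract_theta_mul_theta]

theorem contract_wedge (b c d : Fin 4) (x : M) :
    S.contract (F.coframe c x) (S.wedge (F.coframe b x) (F.theta d x))
      = eta c b • F.theta d x - eta c d • F.theta b x := by
  have h1 : F.theta b x * F.theta d x = S.wedge (F.coframe b x) (F.theta d x) + eta b d • 1 :=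
    F.theta_mul_theta b d x
  rw [← contract_theta_mul_theta, h1, contract, contract, map_add, map_smul,
    CliffordAlgebra.contractLeft_one, smul_zero, add_zero]

theorem diracContract_diracWedge_theta (a : Fin 4) (x : M) :
    F.diracContract (F.diracWedge (F.theta a)) x
      = ∑ c, ∑ b, ∑ d, ((-F.dcoeff c a d b x) • (eta c b • F.theta d x - eta c d • F.theta b x)
        + (-F.coeff a d b x) •
          (∑ k, (-F.coeff b k c x) • (eta c k • F.theta d x - eta c d • F.theta k x)
            + ∑ k, (-F.coeff d k c x) • (eta c b • F.theta k x - eta c k • F.theta b x))) := by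
  rw [diracContract]
  refine Finset.sum_congr rfl fun c _ ↦ ?_
  rw [diracWedge_theta, F.nabla_sum (f := fun (p : Fin 4 × Fin 4) y ↦ -F.coeff a p.2 p.1 y)
    (fun p ↦ (F.mdifferentiableAt_coeff _ _ _ x).neg)]
  simp only [constForm_ι_mul_ι, mvfderiv_neg_coeff, Fintype.sum_prod_type]
  simp only [contract, map_sum, map_add, map_smul]
  simp only [← contract.eq_def, contract_wedge, contract_connBracket_wedge]

theorem theta_eq_ι (a : Fin 4) (x : M) :
    F.theta a x = CliffordAlgebra.ι (S.coform x) (F.coframe a x) := rfl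

/-- The Ricci operator maps `θ^a` to the contraction `-η^{ii} θ^a(R(e_m, e_i) e_i) θ^m` of the
curvature. -/
theorem ricciOperator_theta (a : Fin 4) (x : M) :
    -F.dAlembertian (F.theta a) x + F.diracWedge (F.diracContract (F.theta a)) x
        + F.diracContract (F.diracWedge (F.theta a)) x
      = ∑ m, (-∑ i, minkowski i * F.coframe a x (F.curvature i x (F.e m x) (F.e i x)))
        • F.theta m x := by
  rw [dAlembertian_theta, diracWedge_diracContract_theta, diracContract_diracWedge_theta]
  -- Both sides are images of covectors, which are compared on the tetrad.
  simp only [theta_eq_ι, ← map_smul, ← map_sub, ← map_sum, ← map_add, ← map_neg]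
  congr 1
  refine F.covector_ext fun m ↦ ?_
  simp only [LinearMap.add_apply, LinearMap.neg_apply, LinearMap.sub_apply, LinearMap.sum_apply,
    LinearMap.smul_apply, coframe_e, smul_eq_mul, mul_ite, mul_one, mul_zero, Finset.sum_ite_eq',
    Finset.mem_univ, if_true, eta, mul_sub, mul_add, Finset.sum_add_distrib,
    Finset.sum_sub_distrib, Finset.sum_ite_eq, Finset.sum_ite_irrel, Finset.sum_const_zero,
    Finset.mul_sum]
  -- The only quadratic terms that do not match term by term.
  have hanti : ∑ i, ∑ l, minkowski i * F.coeff l i m x * F.coeff a i l x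
      = -∑ i, ∑ l, minkowski i * F.coeff l i m x * F.coeff a l i x := by
    rw [Finset.sum_comm, ← Finset.sum_neg_distrib]
    refine Finset.sum_congr rfl fun i _ ↦ ?_
    rw [← Finset.sum_neg_distrib]
    refine Finset.sum_congr rfl fun l _ ↦ ?_
    linear_combination F.coeff a l i x * F.coeff_antisymm_right i l m x
  simp only [coframe_curvature]
  simp only [Fin.sum_univ_four] at hanti ⊢
  linear_combination -hanti

/-- The curvature tensor `R_{mkij}` is antisymmetric in its first two indices. -/
theorem coframe_curvature_antisymm (m k i j : Fin 4) (x : M) :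
    minkowski m * F.coframe m x (F.curvature k x (F.e i x) (F.e j x))
      = -(minkowski k * F.coframe k x (F.curvature m x (F.e i x) (F.e j x))) := by
  have h1 : minkowski m *
        ∑ l, (F.coeff l k j x * F.coeff m l i x - F.coeff l k i x * F.coeff m l j x)
      = -(minkowski k *
        ∑ l, (F.coeff l m j x * F.coeff k l i x - F.coeff l m i x * F.coeff k l j x)) := by
    simp only [Finset.mul_sum, ← Finset.sum_neg_distrib]
    refine Finset.sum_congr rfl fun l _ ↦ ?_
    linear_combination F.coeff l k j x * F.coeff_antisymm m l i x
      - F.coeff l k i x * F.coeff_antisymm m l j x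
      - F.coeff l m i x * F.coeff_antisymm l k j x
      + F.coeff l m j x * F.coeff_antisymm l k i x
  have h2 : minkowski m * ∑ l, (F.coeff l j i x - F.coeff l i j x) * F.coeff m k l x
      = -(minkowski k * ∑ l, (F.coeff l j i x - F.coeff l i j x) * F.coeff k m l x) := by
    simp only [Finset.mul_sum, ← Finset.sum_neg_distrib]
    refine Finset.sum_congr rfl fun l _ ↦ ?_
    linear_combination (F.coeff l j i x - F.coeff l i j x) * F.coeff_antisymm m k l x
  rw [coframe_curvature, coframe_curvature]
  linear_combination F.dcoeff_antisymm i m k j x - F.dcoeff_antisymm j m k i x + h1 - h2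

end Tetrad

/-! ### Traces and the field equations in components -/

theorem trace_eq_sum_repr {V : Type*} [AddCommGroup V] [Module ℝ V] (b : Basis (Fin 4) ℝ V)
    (L : V →ₗ[ℝ] V) : LinearMap.trace ℝ V L = ∑ i, b.repr (L (b i)) i := by
  rw [LinearMap.trace_eq_matrix_trace ℝ b, Matrix.trace]
  simp [LinearMap.toMatrix_apply]

/-- The metric trace of a bilinear form `B` is the trace of the endomorphism that represents `B`
with respect to the metric, so it can be computed in any orthonormal basis. -/
theorem sum_minkowski_mul_eq_trace {x : M} (b : Basis (Fin 4) ℝ (TangentSpace (𝓡 4) x))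
    (hb : ∀ i j, S.metric x (b i) (b j) = eta i j)
    (B : LinearMap.BilinForm ℝ (TangentSpace (𝓡 4) x)) :
    ∑ i, minkowski i * B (b i) (b i)
      = LinearMap.trace ℝ _ ((S.sharp x).toLinearMap ∘ₗ B) := by
  rw [trace_eq_sum_repr b]
  refine Finset.sum_congr rfl fun i _ ↦ ?_
  rw [repr_eq_metric b hb]
  congr 1
  exact (LinearMap.BilinForm.apply_toDual_symm_apply (B := S.bilin x)
    (hB := S.bilin_nondegenerate x) (B (b i)) (b i)).symm

namespace Tetrad

variable (F : S.Tetrad)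

theorem metricTrace_eq (x : M) (B : LinearMap.BilinForm ℝ (TangentSpace (𝓡 4) x)) :
    S.metricTrace x (fun u v ↦ B u v) = ∑ i, minkowski i * B (F.e i x) (F.e i x) := by
  have h := sum_minkowski_mul_eq_trace (S := S) (F.basis x) (by simpa using F.orthonormal x) B
  simp only [basis_apply] at h
  rw [h]
  exact sum_minkowski_mul_eq_trace _ (S.metric_stdBasis x) B

/-- The Ricci tensor in tetrad components; the trace in its definition is independent of the
orthonormal basis. -/
theorem ricci_eq (x : M) (u v : TangentSpace (𝓡 4) x) :
    S.ricci x u v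
      = ∑ k, F.coframe k x u * ∑ i, F.coframe i x (F.curvature k x v (F.e i x)) := by
  let L : TangentSpace (𝓡 4) x →ₗ[ℝ] TangentSpace (𝓡 4) x :=
    ∑ k, F.coframe k x u • (F.curvature k x v).toLinearMap
  have hL : ∀ w, S.riemann x v w u = L w := fun w ↦ by simp [L, F.riemann_eq]
  simp only [ricci, hL]
  rw [← trace_eq_sum_repr, trace_eq_sum_repr (F.basis x)]
  simp only [← coframe_eq_repr, basis_apply]
  simp only [L, LinearMap.sum_apply, LinearMap.smul_apply, map_sum,
    map_smul, smul_eq_mul, Finset.mul_sum]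
  exact Finset.sum_comm

/-- The Ricci tensor as a bilinear form. -/
noncomputable def ricciForm (x : M) : LinearMap.BilinForm ℝ (TangentSpace (𝓡 4) x) :=
  LinearMap.mk₂ ℝ (S.ricci x)
    (fun u u' v ↦ by simp [F.ricci_eq, add_mul, Finset.sum_add_distrib])
    (fun c u v ↦ by simp [F.ricci_eq, mul_assoc, Finset.mul_sum])
    (fun u v v' ↦ by simp [F.ricci_eq, mul_add, Finset.sum_add_distrib])
    (fun c u v ↦ by simp [F.ricci_eq, Finset.mul_sum, mul_left_comm])

theorem ricciForm_apply (x : M) (u v : TangentSpace (𝓡 4) x) :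
    F.ricciForm x u v = S.ricci x u v := rfl

/-- The Ricci components as the contraction of the curvature on its first and last indices, the
form in which they occur in the Ricci operator. -/
theorem ricci_e (x : M) (a m : Fin 4) :
    minkowski a * S.ricci x (F.e a x) (F.e m x)
      = -∑ i, minkowski i * F.coframe a x (F.curvature i x (F.e m x) (F.e i x)) := by
  simp only [F.ricci_eq, coframe_e, ite_mul, one_mul, zero_mul, Finset.sum_ite_eq',
    Finset.mem_univ, if_true]
  rw [Finset.mul_sum, ← Finset.sum_neg_distrib]
  refine Finset.sum_congr rfl fun i _ ↦ ?_
  have h := F.coframe_curvature_antisymm i a m i x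
  linear_combination minkowski a * minkowski i * h
    - minkowski a * F.coframe i x (F.curvature a x (F.e m x) (F.e i x)) * minkowski_mul_self i
    - minkowski i * F.coframe a x (F.curvature i x (F.e m x) (F.e i x)) * minkowski_mul_self a

theorem scalarCurvature_eq (x : M) :
    S.scalarCurvature x = ∑ i, minkowski i * S.ricci x (F.e i x) (F.e i x) :=
  F.metricTrace_eq x (F.ricciForm x)

/-- Einstein's equation in components. -/
theorem einsteinEquation_iff (T : Π x : M, LinearMap.BilinForm ℝ (TangentSpace (𝓡 4) x)) :
    S.EinsteinEquation T ↔ ∀ (x : M) (a m : Fin 4),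
      S.ricci x (F.e a x) (F.e m x) - 1 / 2 * S.scalarCurvature x * eta a m
        = T x (F.e a x) (F.e m x) := by
  refine ⟨fun h x a m ↦ by rw [← h, F.orthonormal], fun h x u v ↦ ?_⟩
  have hB : F.ricciForm x - (1 / 2 * S.scalarCurvature x) • S.bilin x = T x := by
    refine LinearMap.BilinForm.ext_basis (F.basis x) fun a m ↦ ?_
    simpa [ricciForm_apply, bilin_apply, F.orthonormal] using h x a m
  rw [← hB]
  simp [ricciForm_apply, bilin_apply]

/-- The equation of the cotetrad fields in components. -/
theorem cotetradEquation_iff (T : Π x : M, LinearMap.BilinForm ℝ (TangentSpace (𝓡 4) x)) :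
    F.CotetradEquation T ↔ ∀ (x : M) (a m : Fin 4),
      S.ricci x (F.e a x) (F.e m x)
        = T x (F.e a x) (F.e m x) - 1 / 2 * S.metricTrace x (fun u v ↦ T x u v) * eta a m := by
  have h1 : ∀ a x, F.energyForm T a x
      - (1 / 2 * S.metricTrace x (fun u v ↦ T x u v)) • F.theta a x
      = S.ofCovector (∑ m, (minkowski a * T x (F.e a x) (F.e m x)) • F.coframe m x
        - (1 / 2 * S.metricTrace x (fun u v ↦ T x u v)) • F.coframe a x) := by
    intro a x
    simp only [energyForm, eta, ite_mul, zero_mul, Finset.sum_ite_eq, Finset.mem_univ, if_true,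
      theta, ofCovector, map_sub, map_sum, map_smul]
  have h2 : ∀ a x, -F.dAlembertian (F.theta a) x + F.diracWedge (F.diracContract (F.theta a)) x
        + F.diracContract (F.diracWedge (F.theta a)) x
      = S.ofCovector (∑ m, (minkowski a * S.ricci x (F.e a x) (F.e m x)) • F.coframe m x) := by
    intro a x
    simp only [ricciOperator_theta, ← ricci_e, theta, ofCovector, map_sum, map_smul]
  have h3 : ∀ a x m, (∑ m, (minkowski a * T x (F.e a x) (F.e m x)) • F.coframe m x
        - (1 / 2 * S.metricTrace x (fun u v ↦ T x u v)) • F.coframe a x) (F.e m x)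
      = minkowski a * (T x (F.e a x) (F.e m x)
        - 1 / 2 * S.metricTrace x (fun u v ↦ T x u v) * eta a m) := by
    intro a x m
    have h : (if a = m then 1 else 0 : ℝ) = minkowski a * eta a m := by
      rw [eta]; split_ifs <;> simp [minkowski_mul_self]
    rw [LinearMap.sub_apply, LinearMap.sum_apply, LinearMap.smul_apply, coframe_e, h]
    simp only [LinearMap.smul_apply, coframe_e, smul_eq_mul, mul_ite, mul_one, mul_zero,
      Finset.sum_ite_eq', Finset.mem_univ, if_true]
    ring
  have h4 : ∀ a x m, (∑ m, (minkowski a * S.ricci x (F.e a x) (F.e m x)) • F.coframe m x)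
      (F.e m x) = minkowski a * S.ricci x (F.e a x) (F.e m x) := by
    intro a x m
    simp [LinearMap.sum_apply]
  simp only [CotetradEquation, h1, h2, (ofCovector_injective _).eq_iff]
  refine ⟨fun h x a m ↦ ?_, fun h a x ↦ F.covector_ext fun m ↦ ?_⟩
  · have := congrArg (fun α ↦ α (F.e m x)) (h a x)
    simp only [h3, h4] at this
    exact mul_left_cancel₀ (minkowski_ne_zero a) this
  · rw [h3, h4, h]

end Tetrad

end LorentzianSpacetime

theorem sum_minkowski_mul_eta : ∑ i, minkowski i * eta i i = 4 := by
  simp [eta, minkowski_mul_self]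

theorem mainTheorem1 {M : Type*} [TopologicalSpace M] [T2Space M] [ParacompactSpace M]
    [ConnectedSpace M] [NoncompactSpace M] [ChartedSpace (EuclideanSpace ℝ (Fin 4)) M]
    [IsManifold (𝓡 4) ∞ M] (S : LorentzianSpacetime M) (F : S.Tetrad)
    (T : Π x : M, LinearMap.BilinForm ℝ (TangentSpace (𝓡 4) x)) :
    (S.EinsteinEquation T ↔ F.CotetradEquation T) ∧
      (S.EinsteinEquation T →
        ∀ x, S.metricTrace x (fun u v ↦ T x u v) = -S.scalarCurvature x) := by
  have htrace : S.EinsteinEquation T →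
      ∀ x, S.metricTrace x (fun u v ↦ T x u v) = -S.scalarCurvature x := by
    intro h x
    rw [F.einsteinEquation_iff] at h
    have h' : ∑ i, minkowski i * T x (F.e i x) (F.e i x)
        = ∑ i, minkowski i * S.ricci x (F.e i x) (F.e i x)
          - 1 / 2 * S.scalarCurvature x * ∑ i, minkowski i * eta i i := by
      rw [Finset.mul_sum, ← Finset.sum_sub_distrib]
      exact Finset.sum_congr rfl fun i _ ↦ by rw [← h]; ring
    rw [sum_minkowski_mul_eta, ← F.scalarCurvature_eq] at h'
    rw [F.metricTrace_eq, h']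
    ring
  refine ⟨⟨fun h ↦ ?_, fun h ↦ ?_⟩, htrace⟩
  · have ht := htrace h
    rw [F.einsteinEquation_iff] at h
    rw [F.cotetradEquation_iff]
    intro x a m
    rw [ht, ← h]
    ring
  · rw [F.cotetradEquation_iff] at h
    rw [F.einsteinEquation_iff]
    intro x a m
    have h' : ∑ i, minkowski i * S.ricci x (F.e i x) (F.e i x)
        = ∑ i, minkowski i * T x (F.e i x) (F.e i x)
          - 1 / 2 * S.metricTrace x (fun u v ↦ T x u v) * ∑ i, minkowski i * eta i i := by
      rw [Finset.mul_sum, ← Finset.sum_sub_distrib]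
      exact Finset.sum_congr rfl fun i _ ↦ by rw [h]; ring
    rw [sum_minkowski_mul_eta, ← F.scalarCurvature_eq, ← F.metricTrace_eq] at h'
    rw [h, h']
    ring
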